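/- Work in a virtual equipment $\mathbb{X}$: a virtual double category (objects, tight-cells $\to$ forming a category, loose-cells, and 2-cells from a finite chain of loose-cells to a single loose-cell, with tight-cells as sides) with all loose-identities $A(1,1)$ and all restrictions $p(f,g)$; write $E(f,g)$ for the restriction of $E(1,1)$ along tight-cells $f, g$ into $E$, and $f ; g$ for the composite of $f$ followed by $g$. Let $j \colon A \to E$ be a tight-cell. $j$ is \emph{dense} if the identity 2-cell exhibits $1_E$ as the $E(j,1)$-weighted colimit of $j$. A \emph{$j$-monad} is a tight-cell $t \colon A \to E$ with 2-cells $\eta \colon j \Rightarrow t$ and $\dagger \colon E(j,t) \Rightarrow E(t,t)$ satisfying the two unit laws and the associativity law of a relative monad. A \emph{$T$-algebra} is a tight-cell $e \colon D \to E$ with a 2-cell $E(j,e) \Rightarrow E(t,e)$ compatible with $\eta$ and $\dagger$; a \emph{graded algebra morphism} $(e \colon D \to E) \to (e' \colon D' \to E)$ is a 2-cell $p_1, \ldots, p_n \Rightarrow E(e, e')$ compatible with the two algebra structures. An \emph{algebra object} for $T$ is a $T$-algebra $u_T \colon \mathbf{Alg}(T) \to E$ such that every $T$-algebra is the restriction of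 $u_T$ along a unique tight-cell into $\mathbf{Alg}(T)$, and every graded algebra morphism $p_1, \ldots, p_n \Rightarrow E(e,e')$ is the image under $u_T$ of a unique 2-cell $p_1, \ldots, p_n \Rightarrow \mathbf{Alg}(T)(c, c')$, where $c, c'$ are the tight-cells corresponding to $e, e'$. A \emph{left $j$-adjoint} of a tight-cell $r \colon D \to E$ is a tight-cell $\ell \colon A \to D$ with an isomorphism $D(\ell,1) \cong E(j,r)$; it induces a $j$-monad with carrier $\ell ; r$, for which $r$ is canonically an algebra. The tight-cell $r$ is \emph{strictly} (respectively \emph{non-strictly}) \emph{$j$-monadic} if it admits a left $j$-adjoint, the induced $j$-monad $S$ admits an algebra object, and the comparison tight-cell $D \to \mathbf{Alg}(S)$, which corresponds to the algebra $r$, is an isomorphism (respectively an equivalence). \textbf{Proposition.} Let $j \colon A \to E$ and $j' \colon E \to E'$ be tight-cells, and suppose that $j'$ is dense. \begin{enumerate} \item Let $T$ be a $(j ; j')$-monad admitting an algebra object. Then $u_T \colon \mathbf{Alg}(T) \to E'$ is strictly $j'$-monadic if and only if it admits a left $j'$-adjoint and the induced $j'$-monad admits an algebra object. \item A non-strictly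 $(j ; j')$-monadic tight-cell $r \colon D \to E'$ is non-strictly $j'$-monadic if and only if it admits a left $j'$-adjoint and the induced $j'$-monad admits an algebra object. \end{enumerate} -/

import Mathlib

open CategoryTheory

set_option linter.checkUnivs false

universe u v w z

namespace RelMonadicity

/-! ### Virtual double categories -/

/-- Chains of composable loose-cells, read from left to right. A loose-cell `p : L A B` is drawn
with `A` on the left and `B` on the right (`p(a, b)` is contravariant in `a` and covariant in `b`);
in arrow notation it is a loose-cell from `B` to `A`. -/
inductive LooseChain {X : Type u} (L : X → X → Type w) : X → X → Type (max u w)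
  | nil (A : X) : LooseChain L A A
  | cons {A B C : X} (p : L A B) (P : LooseChain L B C) : LooseChain L A C

namespace LooseChain

variable {X : Type u} {L : X → X → Type w}

/-- Concatenation of chains. -/
def append : {A B C : X} → LooseChain L A B → LooseChain L B C → LooseChain L A C
  | _, _, _, nil _, R => R
  | _, _, _, cons p P, R => cons p (append P R)

/-- The chain of length one. -/
abbrev single {A B : X} (p : L A B) : LooseChain L A B := cons p (nil B)

theorem append_nil {A B : X} (P : LooseChain L A B) : P.append (nil B) = P := by
  induction P with
  | nil => rfl
  | cons p P ih => exact congrArg (cons p) ih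

theorem append_assoc {A B C D : X} (P : LooseChain L A B) (Q : LooseChain L B C)
    (R : LooseChain L C D) : (P.append Q).append R = P.append (Q.append R) := by
  induction P with
  | nil => rfl
  | cons p P ih => exact congrArg (cons p) (ih Q)

end LooseChain

/-- The cells of a virtual double category: a category of objects and tight-cells, loose-cells, and
2-cells, whose frame has a chain of loose-cells as its top, a single loose-cell as its bottom, and
tight-cells on its two sides. -/
class CellData (X : Type u) extends Category.{v} X where
  /-- `Loose A B` consists of the loose-cells with `A` on the left and `B` on the right. -/
  Loose : X → X → Type w
  /-- `Cell f P g q` consists of the 2-cells with top `P`, bottom `q`, left side `f` and right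
  side `g`. -/
  Cell : ∀ {A B A' B' : X}, (A ⟶ A') → LooseChain Loose A B → (B ⟶ B') → Loose A' B' → Type z

/-- Chains of loose-cells in `X`. -/
abbrev Chain {X : Type u} [CellData.{u, v, w, z} X] (A B : X) : Type (max u w) :=
  LooseChain (CellData.Loose (X := X)) A B


/-- Rows of horizontally adjacent 2-cells: an element of `Cells f P g [q₁, …, qₙ]` is a list of
2-cells `φᵢ : Pᵢ ⇒ qᵢ`, adjacent ones sharing their common side, where `P` is the concatenation of
`P₁, …, Pₙ`. -/
inductive Cells {X : Type u} [CellData.{u, v, w, z} X] :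
    ∀ {A B A' B' : X}, (A ⟶ A') → Chain A B → (B ⟶ B') → Chain A' B' → Type (max u v w z)
  | nil {A A' : X} (f : A ⟶ A') : Cells f (.nil A) f (.nil A')
  | cons {A B C A' B' C' : X} {f : A ⟶ A'} {g : B ⟶ B'} {h : C ⟶ C'} {P : Chain A B}
      {R : Chain B C} {S : Chain A C} {q : CellData.Loose A' B'} {Q : Chain B' C'}
      (φ : CellData.Cell f P g q) (Φ : Cells g R h Q) (hS : P.append R = S) :
      Cells f S h (.cons q Q)

namespace Cells

variable {X : Type u} [CellData.{u, v, w, z} X]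

/-- Horizontal concatenation of rows. -/
def append : {A B C A' B' C' : X} → {f : A ⟶ A'} → {g : B ⟶ B'} → {h : C ⟶ C'} →
    {P : Chain A B} → {Q : Chain A' B'} → {R : Chain B C} → {S : Chain B' C'} →
    Cells f P g Q → Cells g R h S → Cells f (P.append R) h (Q.append S)
  | _, _, _, _, _, _, _, _, _, _, _, _, _, nil _, Ψ => Ψ
  | _, _, _, _, _, _, _, _, _, _, _, _, _, cons φ Φ hS, Ψ =>
      cons φ (append Φ Ψ) (by rw [← hS, LooseChain.append_assoc])

/-- A row consisting of one 2-cell. -/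
abbrev single {A B A' B' : X} {f : A ⟶ A'} {P : Chain A B} {g : B ⟶ B'}
    {q : CellData.Loose A' B'} (φ : CellData.Cell f P g q) : Cells f P g (.single q) :=
  cons φ (nil g) (LooseChain.append_nil P)

/-- A row consisting of two 2-cells. -/
abbrev pair {A B C A' B' C' : X} {f : A ⟶ A'} {g : B ⟶ B'} {h : C ⟶ C'} {P : Chain A B}
    {Q : Chain B C} {q : CellData.Loose A' B'} {r : CellData.Loose B' C'}
    {S : Chain A C} (φ : CellData.Cell f P g q) (ψ : CellData.Cell g Q h r)
    (hS : P.append Q = S) : Cells f S h (.cons q (.single r)) :=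
  cons φ (single ψ) hS

end Cells

/-- The operations of a virtual double category. The composite of a row of 2-cells with a 2-cell
below it has as its sides the composite tight-cells; these are given up to propositional equality,
so that no transport along the category laws is needed. -/
class CellOps (X : Type u) extends CellData.{u, v, w, z} X where
  idCell : ∀ {A B : X} (p : Loose A B), Cell (𝟙 A) (.single p) (𝟙 B) p
  paste : ∀ {A B A' B' A'' B'' : X} {f : A ⟶ A'} {P : LooseChain Loose A B} {g : B ⟶ B'}
    {Q : LooseChain Loose A' B'} {f' : A' ⟶ A''} {g' : B' ⟶ B''} {r : Loose A'' B''}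
    {f'' : A ⟶ A''} {g'' : B ⟶ B''},
    Cells f P g Q → Cell f' Q g' r → f ≫ f' = f'' → g ≫ g' = g'' → Cell f'' P g'' r

open CellData CellOps

/-- The row of identity 2-cells on a chain. -/
def idCells {X : Type u} [CellOps.{u, v, w, z} X] :
    {A B : X} → (Q : Chain A B) → Cells (𝟙 A) Q (𝟙 B) Q
  | _, _, .nil A => .nil (𝟙 A)
  | _, _, .cons q Q => .cons (idCell q) (idCells Q) rfl

/-- `VComp Φ Ψ Θ` says that the row `Θ` is the vertical composite of the row `Φ` with the row `Ψ`
below it: each 2-cell of `Ψ` is composed with the part of `Φ` above it. -/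
inductive VComp {X : Type u} [CellOps.{u, v, w, z} X] :
    ∀ {A B A' B' A'' B'' : X} {f : A ⟶ A'} {P : Chain A B} {g : B ⟶ B'} {Q : Chain A' B'}
      {f' : A' ⟶ A''} {g' : B' ⟶ B''} {R : Chain A'' B''} {f'' : A ⟶ A''} {g'' : B ⟶ B''},
      Cells f P g Q → Cells f' Q g' R → Cells f'' P g'' R → Prop
  | nil {A A' A'' : X} (f : A ⟶ A') (f' : A' ⟶ A'') (f'' : A ⟶ A'') (hf : f ≫ f' = f'') :
      VComp (.nil f) (.nil f') (.nil f'')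
  | cons {A B C A' B' C' A'' B'' C'' : X} {f : A ⟶ A'} {g : B ⟶ B'} {h : C ⟶ C'}
      {P : Chain A B} {R : Chain B C} {Q : Chain A' B'} {S : Chain B' C'}
      {f' : A' ⟶ A''} {g' : B' ⟶ B''} {h' : C' ⟶ C''} {q : Loose A'' B''} {T : Chain B'' C''}
      {f'' : A ⟶ A''} {g'' : B ⟶ B''} {h'' : C ⟶ C''}
      (Φ₁ : Cells f P g Q) (Φ₂ : Cells g R h S) (ψ : Cell f' Q g' q) (Ψ : Cells g' S h' T)
      (Θ : Cells g'' R h'' T) (hf : f ≫ f' = f'') (hg : g ≫ g' = g'') (hΘ : VComp Φ₂ Ψ Θ) :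
      VComp (Φ₁.append Φ₂) (.cons ψ Ψ rfl) (.cons (paste Φ₁ ψ hf hg) Θ rfl)

/-- A virtual double category: composition of 2-cells is unital and associative. -/
class VirtualDoubleCategory (X : Type u) extends CellOps.{u, v, w, z} X where
  id_paste : ∀ {A B A' B' : X} {f : A ⟶ A'} {Q : Chain A B} {g : B ⟶ B'} {r : Loose A' B'}
    (ψ : Cell f Q g r), paste (idCells Q) ψ (Category.id_comp f) (Category.id_comp g) = ψ
  paste_id : ∀ {A B A' B' : X} {f : A ⟶ A'} {P : Chain A B} {g : B ⟶ B'} {q : Loose A' B'}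
    (φ : Cell f P g q),
    paste (Cells.single φ) (idCell q) (Category.comp_id f) (Category.comp_id g) = φ
  paste_assoc : ∀ {A B A' B' A'' B'' A₃ B₃ : X} {f : A ⟶ A'} {P : Chain A B} {g : B ⟶ B'}
    {Q : Chain A' B'} {f' : A' ⟶ A''} {g' : B' ⟶ B''} {R : Chain A'' B''}
    {f'' : A ⟶ A''} {g'' : B ⟶ B''} {k : A'' ⟶ A₃} {l : B'' ⟶ B₃} {s : Loose A₃ B₃}
    {k' : A' ⟶ A₃} {l' : B' ⟶ B₃} {m : A ⟶ A₃} {n : B ⟶ B₃}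
    {Φ : Cells f P g Q} {Ψ : Cells f' Q g' R} {Θ : Cells f'' P g'' R} (_ : VComp Φ Ψ Θ)
    (χ : Cell k R l s) (hk : f' ≫ k = k') (hl : g' ≫ l = l') (hm : f ≫ k' = m)
    (hn : g ≫ l' = n) (hm' : f'' ≫ k = m) (hn' : g'' ≫ l = n),
    paste Φ (paste Ψ χ hk hl) hm hn = paste Θ χ hm' hn'

/-- A virtual equipment: a virtual double category with (chosen) loose-identities and (chosen)
restrictions. -/
class VirtualEquipment (X : Type u) extends VirtualDoubleCategory.{u, v, w, z} X where
  /-- The loose-identity `A(1, 1)`. -/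
  unit : ∀ A : X, Loose A A
  /-- The opcartesian 2-cell exhibiting the loose-identity. -/
  unitCell : ∀ A : X, Cell (𝟙 A) (.nil A) (𝟙 A) (unit A)
  unit_existsUnique : ∀ {A' A B' A'' B'' : X} (L : Chain A' A) (R : Chain A B')
    {f : A' ⟶ A''} {g : B' ⟶ B''} {q : Loose A'' B''} (φ : Cell f (L.append R) g q),
    ∃! ψ : Cell f (L.append (.cons (unit A) R)) g q,
      paste ((idCells L).append (Cells.cons (unitCell A) (idCells R) rfl)) ψ
        (Category.id_comp f) (Category.id_comp g) = φ
  /-- The restriction `p(f, g)`. -/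
  res : ∀ {A B A' B' : X} (_ : Loose A B) (_ : A' ⟶ A) (_ : B' ⟶ B), Loose A' B'
  /-- The cartesian 2-cell exhibiting the restriction. -/
  resCell : ∀ {A B A' B' : X} (p : Loose A B) (f : A' ⟶ A) (g : B' ⟶ B),
    Cell f (.single (res p f g)) g p
  res_existsUnique : ∀ {A B A' B' C D : X} (p : Loose A B) (f : A' ⟶ A) (g : B' ⟶ B)
    (P : Chain C D) (h : C ⟶ A') (k : D ⟶ B') (φ : Cell (h ≫ f) P (k ≫ g) p),
    ∃! ψ : Cell h P k (res p f g), paste (Cells.single ψ) (resCell p f g) rfl rfl = φ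

open VirtualDoubleCategory VirtualEquipment

section

variable {X : Type u} [VirtualEquipment.{u, v, w, z} X]

/-! ### Hom loose-cells and graded 2-cells between tight-cells -/

/-- The loose-cell `E(f, g)`. -/
abbrev hom {A B E : X} (f : A ⟶ E) (g : B ⟶ E) : Loose A B := res (unit E) f g

/-- For tight-cells `f` and `g` into `E` and a chain `P`, the 2-cells from `P` to the loose-identity
on `E` with sides `f` and `g`. For empty `P`, these are the 2-cells `f ⇒ g`. -/
abbrev Gr {A B E : X} (f : A ⟶ E) (P : Chain A B) (g : B ⟶ E) : Type z := Cell f P g (unit E)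

/-- The 2-cells `f ⇒ g` between parallel tight-cells. -/
abbrev TightCell₂ {A E : X} (f g : A ⟶ E) : Type z := Gr f (.nil A) g

/-- The cartesian 2-cell from `E(f, g)` to `E(1, 1)`. -/
abbrev cart {A B E : X} (f : A ⟶ E) (g : B ⟶ E) : Gr f (.single (hom f g)) g :=
  resCell (unit E) f g

theorem exists_lift {A B C D E : X} {f : A ⟶ E} {g : B ⟶ E} {P : Chain C D} {h : C ⟶ A}
    {k : D ⟶ B} {f' : C ⟶ E} {g' : D ⟶ E} (φ : Gr f' P g') (hf : h ≫ f = f') (hg : k ≫ g = g') :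
    ∃! ψ : Cell h P k (hom f g), paste (Cells.single ψ) (cart f g) hf hg = φ := by
  subst hf hg
  exact res_existsUnique (unit E) f g P h k φ

/-- The 2-cell into `E(f, g)` induced by the universal property of the restriction. -/
noncomputable def lift {A B C D E : X} {f : A ⟶ E} {g : B ⟶ E} {P : Chain C D} {h : C ⟶ A}
    {k : D ⟶ B} {f' : C ⟶ E} {g' : D ⟶ E} (φ : Gr f' P g') (hf : h ≫ f = f') (hg : k ≫ g = g') :
    Cell h P k (hom f g) := (exists_lift φ hf hg).choose

theorem lift_cart {A B C D E : X} {f : A ⟶ E} {g : B ⟶ E} {P : Chain C D} {h : C ⟶ A}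
    {k : D ⟶ B} {f' : C ⟶ E} {g' : D ⟶ E} (φ : Gr f' P g') (hf : h ≫ f = f') (hg : k ≫ g = g') :
    paste (Cells.single (lift φ hf hg)) (cart f g) hf hg = φ :=
  (exists_lift φ hf hg).choose_spec.1

theorem lift_uniq {A B C D E : X} {f : A ⟶ E} {g : B ⟶ E} {P : Chain C D} {h : C ⟶ A}
    {k : D ⟶ B} {f' : C ⟶ E} {g' : D ⟶ E} {φ : Gr f' P g'} {hf : h ≫ f = f'} {hg : k ≫ g = g'}
    {ψ : Cell h P k (hom f g)} (hψ : paste (Cells.single ψ) (cart f g) hf hg = φ) :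
    ψ = lift φ hf hg :=
  (exists_lift φ hf hg).choose_spec.2 ψ hψ

theorem hom_ext {A B C D E : X} {f : A ⟶ E} {g : B ⟶ E} {P : Chain C D} {h : C ⟶ A}
    {k : D ⟶ B} {f' : C ⟶ E} {g' : D ⟶ E} {hf : h ≫ f = f'} {hg : k ≫ g = g'}
    {ψ ψ' : Cell h P k (hom f g)}
    (e : paste (Cells.single ψ) (cart f g) hf hg = paste (Cells.single ψ') (cart f g) hf hg) :
    ψ = ψ' :=
  (lift_uniq e).trans (lift_uniq rfl).symm

/-- The 2-cell `P ⇒ E(f, g)` corresponding to a 2-cell `P ⇒ E(1, 1)` with sides `f` and `g`. -/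
noncomputable abbrev toHom {A B E : X} {f : A ⟶ E} {P : Chain A B} {g : B ⟶ E} (φ : Gr f P g) :
    Cell (𝟙 A) P (𝟙 B) (hom f g) :=
  lift φ (Category.id_comp f) (Category.id_comp g)

/-- The 2-cell `P ⇒ E(1, 1)` with sides `f` and `g` corresponding to a 2-cell `P ⇒ E(f, g)`. -/
abbrev ofHom {A B E : X} {f : A ⟶ E} {P : Chain A B} {g : B ⟶ E}
    (φ : Cell (𝟙 A) P (𝟙 B) (hom f g)) : Gr f P g :=
  paste (Cells.single φ) (cart f g) (Category.id_comp f) (Category.id_comp g)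

/-- The identity 2-cell `f ⇒ f`. -/
def idGr {A E : X} (f : A ⟶ E) : TightCell₂ f f :=
  paste (.nil f) (unitCell E) (Category.comp_id f) (Category.comp_id f)

/-- The composition `E(1, 1), E(1, 1) ⇒ E(1, 1)`, inverse to the unit in one variable. -/
noncomputable def unitMul (E : X) :
    Cell (𝟙 E) (.cons (unit E) (.single (unit E))) (𝟙 E) (unit E) :=
  (unit_existsUnique (.nil E) (.single (unit E)) (idCell (unit E))).choose

/-- Composition of 2-cells along a common tight-cell. For empty chains this is the composition of
2-cells between parallel tight-cells. -/
noncomputable def mul {A B C E : X} {f : A ⟶ E} {P : Chain A B} {g : B ⟶ E} {Q : Chain B C}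
    {h : C ⟶ E} {S : Chain A C} (α : Gr f P g) (β : Gr g Q h) (hS : P.append Q = S) : Gr f S h :=
  paste (Cells.pair α β hS) (unitMul E) (Category.comp_id f) (Category.comp_id h)

/-- The composition 2-cell `E(f, g), E(g, h) ⇒ E(f, h)`. -/
noncomputable def homMul {A B C E : X} (f : A ⟶ E) (g : B ⟶ E) (h : C ⟶ E) :
    Cell (𝟙 A) (.cons (hom f g) (.single (hom g h))) (𝟙 C) (hom f h) :=
  toHom (mul (cart f g) (cart g h) rfl)

/-- Globular composition of a row of globular 2-cells with a globular 2-cell. -/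
abbrev gcomp {A B : X} {P Q : Chain A B} {r : Loose A B} (Φ : Cells (𝟙 A) P (𝟙 B) Q)
    (ψ : Cell (𝟙 A) Q (𝟙 B) r) : Cell (𝟙 A) P (𝟙 B) r :=
  paste Φ ψ (Category.comp_id _) (Category.comp_id _)

theorem exists_tightUnit {C E : X} (r : C ⟶ E) :
    ∃! ψ : Gr r (.single (unit C)) r,
      paste (Cells.single (unitCell C)) ψ (Category.id_comp r) (Category.id_comp r) = idGr r :=
  unit_existsUnique (.nil C) (.nil C) (idGr r)

/-- The action `C(1, 1) ⇒ E(r, r)` of a tight-cell `r : C ⟶ E` on loose-identities. -/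
noncomputable def tightUnit {C E : X} (r : C ⟶ E) : Gr r (.single (unit C)) r :=
  (exists_tightUnit r).choose

/-- Whiskering of a 2-cell with a tight-cell `r`. -/
noncomputable def whisker {A B C E : X} {f : A ⟶ C} {P : Chain A B} {g : B ⟶ C} (α : Gr f P g)
    (r : C ⟶ E) {f' : A ⟶ E} {g' : B ⟶ E} (hf : f ≫ r = f') (hg : g ≫ r = g') : Gr f' P g' :=
  paste (Cells.single α) (tightUnit r) hf hg

/-- The action on graded 2-cells, by composition, of a globular 2-cell
`φ : E(f, g) ⇒ E'(f', g')` restricted along `k` on the right. -/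
noncomputable def act {A B D E E' : X} {f : A ⟶ E} {g : B ⟶ E} {f' : A ⟶ E'} {g' : B ⟶ E'}
    (φ : Cell (𝟙 A) (.single (hom f g)) (𝟙 B) (hom f' g')) (k : D ⟶ B) {P : Chain A D}
    {g₁ : D ⟶ E} {g₂ : D ⟶ E'} (h₁ : k ≫ g = g₁) (h₂ : k ≫ g' = g₂) (a : Gr f P g₁) :
    Gr f' P g₂ :=
  paste (Cells.single (lift a (Category.id_comp f) h₁))
    (paste (Cells.single φ) (cart f' g') (Category.id_comp f') (Category.id_comp g'))
    (Category.id_comp f') h₂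

/-- The restriction `φ(1, k) : E(f, k ≫ g) ⇒ E'(f', k ≫ g')` of a globular 2-cell
`φ : E(f, g) ⇒ E'(f', g')`. -/
noncomputable def restrictRight {A B D E E' : X} {f : A ⟶ E} {g : B ⟶ E} {f' : A ⟶ E'}
    {g' : B ⟶ E'} (φ : Cell (𝟙 A) (.single (hom f g)) (𝟙 B) (hom f' g')) (k : D ⟶ B)
    {g₁ : D ⟶ E} {g₂ : D ⟶ E'} (h₁ : k ≫ g = g₁) (h₂ : k ≫ g' = g₂) :
    Cell (𝟙 A) (.single (hom f g₁)) (𝟙 D) (hom f' g₂) :=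
  toHom (act φ k h₁ h₂ (cart f g₁))

/-! ### Pasting lemmas -/

theorem Cells.cons_heq {A B C A' B' C' : X} {f : A ⟶ A'} {g : B ⟶ B'} {h : C ⟶ C'} {P : Chain A B}
    {R R' : Chain B C} {S S' : Chain A C} {q : Loose A' B'} {Q Q' : Chain B' C'}
    (φ : Cell f P g q) {Φ : Cells g R h Q} {Φ' : Cells g R' h Q'} (hS : P.append R = S)
    (hS' : P.append R' = S') (hR : R = R') (hQ : Q = Q') (hΦ : HEq Φ Φ') :
    HEq (Cells.cons φ Φ hS) (Cells.cons φ Φ' hS') := by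
  subst hR hQ hS hS' hΦ
  rfl

theorem Cells.append_nil_heq {A B A' B' : X} {f : A ⟶ A'} {g : B ⟶ B'} {P : Chain A B}
    {Q : Chain A' B'} (Φ : Cells f P g Q) : HEq (Φ.append (Cells.nil g)) Φ := by
  induction Φ with
  | nil => rfl
  | cons φ Φ hS ih =>
    exact Cells.cons_heq φ _ _ (LooseChain.append_nil _) (LooseChain.append_nil _) ih

theorem VComp.cons_heq {A B C A' B' C' A'' B'' C'' : X} {f : A ⟶ A'} {g : B ⟶ B'} {h : C ⟶ C'}
    {P : Chain A B} {R : Chain B C} {S : Chain A C} {Q : Chain A' B'} {V : Chain B' C'}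
    {U : Chain A' C'}
    {f' : A' ⟶ A''} {g' : B' ⟶ B''} {h' : C' ⟶ C''} {q : Loose A'' B''} {T : Chain B'' C''}
    {f'' : A ⟶ A''} {g'' : B ⟶ B''} {h'' : C ⟶ C''} (Φ : Cells f S h U)
    (Φ₁ : Cells f P g Q) (Φ₂ : Cells g R h V) (ψ : Cell f' Q g' q) (Ψ : Cells g' V h' T)
    (Θ : Cells g'' R h'' T) (hf : f ≫ f' = f'') (hg : g ≫ g' = g'') (hS : P.append R = S)
    (hU : Q.append V = U) (hΦ : HEq Φ (Φ₁.append Φ₂)) (hΘ : VComp Φ₂ Ψ Θ) :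
    VComp Φ (.cons ψ Ψ hU) (.cons (paste Φ₁ ψ hf hg) Θ hS) := by
  subst hS hU hΦ
  exact VComp.cons Φ₁ Φ₂ ψ Ψ Θ hf hg hΘ

theorem VComp.single {A B A' B' A'' B'' : X} {f : A ⟶ A'} {P : Chain A B} {g : B ⟶ B'}
    {Q : Chain A' B'} {f' : A' ⟶ A''} {g' : B' ⟶ B''} {q : Loose A'' B''} {f'' : A ⟶ A''}
    {g'' : B ⟶ B''} (Φ : Cells f P g Q) (ψ : Cell f' Q g' q) (hf : f ≫ f' = f'')
    (hg : g ≫ g' = g'') : VComp Φ (Cells.single ψ) (Cells.single (paste Φ ψ hf hg)) :=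
  VComp.cons_heq Φ Φ (.nil g) ψ (.nil g') (.nil g'') hf hg _ _ Φ.append_nil_heq.symm
    (VComp.nil g g' g'' hg)

/-- Associativity of pasting for a single middle 2-cell. -/
theorem paste_single {A B A' B' A'' B'' A₃ B₃ : X} {f : A ⟶ A'} {P : Chain A B} {g : B ⟶ B'}
    {Q : Chain A' B'} {f' : A' ⟶ A''} {g' : B' ⟶ B''} {q : Loose A'' B''} {f'' : A ⟶ A''}
    {g'' : B ⟶ B''} {k : A'' ⟶ A₃} {l : B'' ⟶ B₃} {s : Loose A₃ B₃} {k' : A' ⟶ A₃}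
    {l' : B' ⟶ B₃} {m : A ⟶ A₃} {n : B ⟶ B₃} (Φ : Cells f P g Q) (ψ : Cell f' Q g' q)
    (χ : Cell k (.single q) l s) (hf : f ≫ f' = f'') (hg : g ≫ g' = g'')
    (hk : f' ≫ k = k') (hl : g' ≫ l = l') (hm : f ≫ k' = m)
    (hn : g ≫ l' = n) (hm' : f'' ≫ k = m) (hn' : g'' ≫ l = n) :
    paste Φ (paste (Cells.single ψ) χ hk hl) hm hn =
      paste (Cells.single (paste Φ ψ hf hg)) χ hm' hn' :=
  paste_assoc (VComp.single Φ ψ hf hg) χ hk hl hm hn hm' hn'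

theorem unitMul_spec (E : X) :
    paste (Cells.cons (unitCell E) (Cells.single (idCell (unit E))) rfl) (unitMul E)
      (Category.id_comp (𝟙 E)) (Category.id_comp (𝟙 E)) = idCell (unit E) :=
  (unit_existsUnique (.nil E) (.single (unit E)) (idCell (unit E))).choose_spec.1

theorem tightUnit_spec {C E : X} (r : C ⟶ E) :
    paste (Cells.single (unitCell C)) (tightUnit r) (Category.id_comp r) (Category.id_comp r) =
      idGr r :=
  (exists_tightUnit r).choose_spec.1

theorem id_mul {A B E : X} {f : A ⟶ E} {P : Chain A B} {g : B ⟶ E} (α : Gr f P g) :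
    mul (idGr f) α rfl = α := by
  have h := paste_assoc (VComp.cons (Cells.nil f) (Cells.single α) (unitCell E)
    (Cells.single (idCell (unit E))) _ (Category.comp_id f) (Category.comp_id f)
    (VComp.single (Cells.single α) (idCell (unit E)) (Category.comp_id f) (Category.comp_id g)))
    (unitMul E) (Category.id_comp (𝟙 E)) (Category.id_comp (𝟙 E)) (Category.comp_id f)
    (Category.comp_id g) (Category.comp_id f) (Category.comp_id g)
  rw [paste_id] at h
  refine h.symm.trans ?_
  refine (congrArg (fun x => paste (Cells.single α) x (Category.comp_id f) (Category.comp_id g))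
    (unitMul_spec E)).trans (paste_id α)

theorem unitMul_spec' (E : X) :
    paste (Cells.cons (idCell (unit E)) (Cells.single (unitCell E)) rfl) (unitMul E)
      (Category.id_comp (𝟙 E)) (Category.id_comp (𝟙 E)) = idCell (unit E) := by
  refine (unit_existsUnique (.nil E) (.nil E) (unitCell E)).unique ?_ (paste_id _)
  have e : idGr (𝟙 E) = unitCell E := id_paste (unitCell E)
  have h := paste_assoc (VComp.cons (Cells.single (unitCell E)) (Cells.nil (𝟙 E))
    (idCell (unit E)) (Cells.single (unitCell E)) _ (Category.comp_id (𝟙 E))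
    (Category.comp_id (𝟙 E)) (VComp.single (Cells.nil (𝟙 E)) (unitCell E) (Category.comp_id (𝟙 E))
    (Category.comp_id (𝟙 E))))
    (unitMul E) (Category.id_comp (𝟙 E)) (Category.id_comp (𝟙 E)) (Category.comp_id (𝟙 E))
    (Category.comp_id (𝟙 E)) (Category.comp_id (𝟙 E)) (Category.comp_id (𝟙 E))
  refine h.trans ?_
  rw [paste_id]
  have h2 := id_mul (unitCell E)
  rw [e] at h2
  exact (congrArg (fun x => mul (unitCell E) x rfl) e).trans h2

theorem mul_id {A B E : X} {f : A ⟶ E} {P : Chain A B} {g : B ⟶ E} (α : Gr f P g) :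
    mul α (idGr g) (LooseChain.append_nil P) = α := by
  have h := paste_assoc (VComp.cons_heq (Cells.single α) (Cells.single α) (Cells.nil g)
    (idCell (unit E)) (Cells.single (unitCell E)) _ (Category.comp_id f) (Category.comp_id g)
    (LooseChain.append_nil P) rfl (Cells.append_nil_heq _).symm
    (VComp.single (Cells.nil g) (unitCell E) (Category.comp_id g) (Category.comp_id g)))
    (unitMul E) (Category.id_comp (𝟙 E)) (Category.id_comp (𝟙 E)) (Category.comp_id f)
    (Category.comp_id g) (Category.comp_id f) (Category.comp_id g)
  rw [paste_id] at h
  refine h.symm.trans ?_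
  refine (congrArg (fun x => paste (Cells.single α) x (Category.comp_id f) (Category.comp_id g))
    (unitMul_spec' E)).trans (paste_id α)

/-- Pasting a row on top of a composite of graded 2-cells. -/
theorem paste_mul {A B C A' B' C' E : X} {f : A ⟶ A'} {g : B ⟶ B'} {h : C ⟶ C'} {P : Chain A B}
    {Q : Chain A' B'} {R : Chain B C} {S : Chain B' C'} (Φ : Cells f P g Q) (Ψ : Cells g R h S)
    {x : A' ⟶ E} {y : B' ⟶ E} {t : C' ⟶ E} {x' : A ⟶ E} {y' : B ⟶ E} {t' : C ⟶ E}
    (α : Gr x Q y) (β : Gr y S t) (hx : f ≫ x = x') (hy : g ≫ y = y') (ht : h ≫ t = t') :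
    paste (Φ.append Ψ) (mul α β rfl) hx ht =
      mul (paste Φ α hx hy) (paste Ψ β hy ht) rfl :=
  paste_assoc (VComp.cons Φ Ψ α (Cells.single β) _ hx hy (VComp.single Ψ β hy ht)) (unitMul E)
    (Category.comp_id x) (Category.comp_id t) hx ht (Category.comp_id x') (Category.comp_id t')

theorem whisker_idGr {A C E : X} (f : A ⟶ C) (r : C ⟶ E) {f' : A ⟶ E} (hf : f ≫ r = f') :
    whisker (idGr f) r hf hf = idGr f' := by
  subst hf
  have h1 := paste_single (Cells.nil f) (unitCell C) (tightUnit r) (Category.comp_id f)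
    (Category.comp_id f) (Category.id_comp r) (Category.id_comp r) rfl rfl rfl rfl
  rw [tightUnit_spec] at h1
  refine h1.symm.trans ?_
  exact paste_assoc (VComp.nil f r (f ≫ r) rfl) (unitCell E) (Category.comp_id r)
    (Category.comp_id r) rfl rfl _ _

theorem tightUnit_mul {C E : X} (r : C ⟶ E) :
    paste (Cells.single (unitMul C)) (tightUnit r) (Category.id_comp r) (Category.id_comp r) =
      mul (tightUnit r) (tightUnit r) rfl := by
  refine (unit_existsUnique (.nil C) (.single (unit C)) (tightUnit r)).unique ?_ ?_
  · refine (paste_single _ (unitMul C) (tightUnit r) (Category.id_comp (𝟙 C))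
      (Category.id_comp (𝟙 C)) _ _ _ _ (Category.id_comp r) (Category.id_comp r)).trans ?_
    have h := unitMul_spec C
    refine (congrArg (fun x => paste (Cells.single x) (tightUnit r) (Category.id_comp r)
      (Category.id_comp r)) h).trans ?_
    exact id_paste (tightUnit r)
  · refine (paste_mul (Cells.single (unitCell C)) (Cells.single (idCell (unit C))) (tightUnit r)
      (tightUnit r) (Category.id_comp r) (Category.id_comp r) (Category.id_comp r)).trans ?_
    rw [tightUnit_spec]
    have h : paste (Cells.single (idCell (unit C))) (tightUnit r) (Category.id_comp r)
      (Category.id_comp r) = tightUnit r := id_paste (tightUnit r)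
    rw [h]
    exact id_mul _

/-- Whiskering preserves composition. -/
theorem whisker_mul {A B D C E : X} {f : A ⟶ C} {P : Chain A B} {g : B ⟶ C} {Q : Chain B D}
    {h : D ⟶ C} {S : Chain A D} (α : Gr f P g) (β : Gr g Q h) (hS : P.append Q = S) (r : C ⟶ E)
    {f' : A ⟶ E} {g' : B ⟶ E} {h' : D ⟶ E} (hf : f ≫ r = f') (hg : g ≫ r = g')
    (hh : h ≫ r = h') :
    whisker (mul α β hS) r hf hh = mul (whisker α r hf hg) (whisker β r hg hh) hS := by
  subst hS
  refine (paste_single _ (unitMul C) (tightUnit r) _ _ (Category.id_comp r) (Category.id_comp r)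
    hf hh hf hh).symm.trans ?_
  rw [tightUnit_mul]
  exact paste_mul (Cells.single α) (Cells.single β) (tightUnit r) (tightUnit r) hf hg hh

/-- Pasting is natural for whiskering. -/
theorem paste_whisker {A B A' B' C E : X} {f : A ⟶ A'} {P : Chain A B} {g : B ⟶ B'}
    {Q : Chain A' B'} (Φ : Cells f P g Q) {x : A' ⟶ C} {y : B' ⟶ C} (α : Gr x Q y) (r : C ⟶ E)
    {x₁ : A' ⟶ E} {y₁ : B' ⟶ E} {x₂ : A ⟶ C} {y₂ : B ⟶ C} {x₃ : A ⟶ E} {y₃ : B ⟶ E}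
    (hx : x ≫ r = x₁) (hy : y ≫ r = y₁) (hx₂ : f ≫ x = x₂) (hy₂ : g ≫ y = y₂)
    (hx₃ : f ≫ x₁ = x₃) (hy₃ : g ≫ y₁ = y₃) (hx₄ : x₂ ≫ r = x₃) (hy₄ : y₂ ≫ r = y₃) :
    paste Φ (whisker α r hx hy) hx₃ hy₃ = whisker (paste Φ α hx₂ hy₂) r hx₄ hy₄ :=
  paste_single Φ α (tightUnit r) hx₂ hy₂ hx hy hx₃ hy₃ hx₄ hy₄

section act

variable {A B D E E' : X} {f : A ⟶ E} {g : B ⟶ E} {f' : A ⟶ E'} {g' : B ⟶ E'}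
  (φ : Cell (𝟙 A) (.single (hom f g)) (𝟙 B) (hom f' g')) (k : D ⟶ B)
  {g₁ : D ⟶ E} {g₂ : D ⟶ E'} (h₁ : k ≫ g = g₁) (h₂ : k ≫ g' = g₂)

theorem paste_act {A' D' : X} {P : Chain A' D'} {Q : Chain A D} {m : D' ⟶ D} {l : A' ⟶ A}
    (Φ : Cells l P m Q) (a : Gr f Q g₁) {f₂ : A' ⟶ E} {g₃ : D' ⟶ E}
    {f₃ : A' ⟶ E'} {g₄ : D' ⟶ E'} (hf₂ : l ≫ f = f₂) (hg₃ : m ≫ g₁ = g₃) (hf₃ : l ≫ f' = f₃)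
    (hg₄ : m ≫ g₂ = g₄) (h₃ : (m ≫ k) ≫ g = g₃) (h₄ : (m ≫ k) ≫ g' = g₄) :
    paste Φ (act φ k h₁ h₂ a) hf₃ hg₄ =
      paste (Cells.single (lift (paste Φ a hf₂ hg₃) hf₂ h₃))
        (paste (Cells.single φ) (cart f' g') (Category.id_comp f') (Category.id_comp g'))
        hf₃ h₄ := by
  refine (paste_single Φ (lift a (Category.id_comp f) h₁) _ (Category.comp_id l) rfl _ _ _ _
    hf₃ h₄).trans ?_
  congr 2
  apply lift_uniq
  refine (paste_single Φ (lift a (Category.id_comp f) h₁) (cart f g) (Category.comp_id l) rfl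
    (Category.id_comp f) h₁ hf₂ hg₃ hf₂ h₃).symm.trans ?_
  rw [lift_cart]

/-- Pasting is natural for the action. -/
theorem paste_act' {D' : X} {P : Chain A D'} {Q : Chain A D} {m : D' ⟶ D}
    (Φ : Cells (𝟙 A) P m Q) (a : Gr f Q g₁) {g₃ : D' ⟶ E} {g₄ : D' ⟶ E'} {k' : D' ⟶ B}
    (hk : m ≫ k = k') (hg₃ : m ≫ g₁ = g₃) (hg₄ : m ≫ g₂ = g₄) (h₃ : k' ≫ g = g₃)
    (h₄ : k' ≫ g' = g₄) :
    paste Φ (act φ k h₁ h₂ a) (Category.id_comp f') hg₄ =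
      act φ k' h₃ h₄ (paste Φ a (Category.id_comp f) hg₃) := by
  subst hk
  exact paste_act φ k h₁ h₂ Φ a _ hg₃ _ hg₄ h₃ h₄

theorem lift_act {P : Chain A D} (a : Gr f P g₁) :
    lift (act φ k h₁ h₂ a) (Category.id_comp f') h₂ =
      paste (Cells.single (lift a (Category.id_comp f) h₁)) φ (Category.id_comp (𝟙 A))
        (Category.comp_id k) :=
  (lift_uniq (paste_single _ φ (cart f' g') _ _ _ _ _ _ _ _).symm).symm

theorem act_act {E'' : X} {f'' : A ⟶ E''} {g'' : B ⟶ E''}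
    (ψ : Cell (𝟙 A) (.single (hom f' g')) (𝟙 B) (hom f'' g'')) {g₃ : D ⟶ E''}
    (h₃ : k ≫ g'' = g₃) {P : Chain A D} (a : Gr f P g₁) :
    act ψ k h₂ h₃ (act φ k h₁ h₂ a) = act (gcomp (Cells.single φ) ψ) k h₁ h₃ a := by
  unfold act
  have h := lift_act φ k h₁ h₂ a
  unfold act at h
  rw [h]
  refine (paste_single _ φ _ _ _ (Category.id_comp f'') (Category.id_comp g'')
    (Category.id_comp f'') h₃ _ _).symm.trans ?_
  congr 1
  exact paste_single _ ψ _ _ _ _ _ _ _ _ _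

theorem act_id {P : Chain A D} (a : Gr f P g₁) : act (idCell (hom f g)) k h₁ h₁ a = a := by
  unfold act
  have h : paste (Cells.single (idCell (hom f g))) (cart f g) (Category.id_comp f)
    (Category.id_comp g) = cart f g := id_paste (cart f g)
  rw [h]
  exact lift_cart a _ h₁

theorem act_cart : act φ (𝟙 B) (Category.id_comp g) (Category.id_comp g') (cart f g) = ofHom φ := by
  have e : lift (cart f g) (Category.id_comp f) (Category.id_comp g) = idCell (hom f g) :=
    (lift_uniq (id_paste (cart f g))).symm
  unfold act
  rw [e]
  exact id_paste _

theorem act_mul_tightUnit :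
    act φ (𝟙 B) (Category.id_comp g) (Category.id_comp g') (mul (cart f g) (tightUnit g) rfl) =
      mul (act φ (𝟙 B) (Category.id_comp g) (Category.id_comp g') (cart f g)) (tightUnit g')
        rfl := by
  refine (unit_existsUnique (.single (hom f g)) (.nil B) (act φ (𝟙 B) (Category.id_comp g)
    (Category.id_comp g') (cart f g))).unique ?_ ?_
  · refine (paste_act' φ (𝟙 B) (Category.id_comp g) (Category.id_comp g') _ _
      (Category.id_comp (𝟙 B)) (Category.id_comp g) (Category.id_comp g')
      (Category.id_comp g) (Category.id_comp g')).trans ?_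
    congr 1
    refine (paste_mul (idCells (.single (hom f g))) (Cells.single (unitCell B)) (cart f g)
      (tightUnit g) (Category.id_comp f) (Category.id_comp g) (Category.id_comp g)).trans ?_
    rw [tightUnit_spec, id_paste]
    exact mul_id (cart f g)
  · refine (paste_mul (idCells (.single (hom f g))) (Cells.single (unitCell B)) _
      (tightUnit g') (Category.id_comp f') (Category.id_comp g') (Category.id_comp g')).trans ?_
    rw [tightUnit_spec, id_paste]
    exact mul_id _

/-- The action of a globular 2-cell is natural with respect to composition on the right. -/
theorem act_mul {D' : X} {P : Chain A D} {Q : Chain D D'} {S : Chain A D'} (a : Gr f P g₁)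
    {m : D' ⟶ B} (b : Gr k Q m) (hS : P.append Q = S) {g₃ : D' ⟶ E} {g₄ : D' ⟶ E'}
    (h₃ : m ≫ g = g₃) (h₄ : m ≫ g' = g₄) :
    act φ m h₃ h₄ (mul a (whisker b g h₁ h₃) hS) =
      mul (act φ k h₁ h₂ a) (whisker b g' h₂ h₄) hS := by
  subst hS
  have e : mul a (whisker b g h₁ h₃) rfl =
      paste ((Cells.single (lift a (Category.id_comp f) h₁)).append (Cells.single b))
        (mul (cart f g) (tightUnit g) rfl) (Category.id_comp f) h₃ := by
    refine Eq.symm ((paste_mul _ _ (cart f g) (tightUnit g) (Category.id_comp f) h₁ h₃).trans ?_)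
    rw [lift_cart]
    rfl
  rw [e]
  refine (paste_act' φ (𝟙 B) (Category.id_comp g) (Category.id_comp g') _ _
    (Category.comp_id m) h₃ h₄ h₃ h₄).symm.trans ?_
  rw [act_mul_tightUnit]
  refine (paste_mul _ _ _ (tightUnit g') (Category.id_comp f') h₂ h₄).trans ?_
  rw [paste_act' φ (𝟙 B) (Category.id_comp g) (Category.id_comp g') _ _
    (Category.comp_id k) h₁ h₂ h₁ h₂, lift_cart]
  rfl

end act

theorem ofHom_toHom {A B E : X} {f : A ⟶ E} {P : Chain A B} {g : B ⟶ E} (φ : Gr f P g) :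
    ofHom (toHom φ) = φ :=
  lift_cart φ _ _

theorem ofHom_gcomp {A B E : X} {f : A ⟶ E} {P Q : Chain A B} {g : B ⟶ E}
    (Φ : Cells (𝟙 A) P (𝟙 B) Q) (ψ : Cell (𝟙 A) Q (𝟙 B) (hom f g)) :
    ofHom (gcomp Φ ψ) = paste Φ (ofHom ψ) (Category.id_comp f) (Category.id_comp g) :=
  (paste_single Φ ψ (cart f g) _ _ _ _ _ _ _ _).symm

theorem ofHom_homMul {A B C E : X} {f : A ⟶ E} {g : B ⟶ E} {h : C ⟶ E} {P : Chain A B}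
    {Q : Chain B C} (α : Cell (𝟙 A) P (𝟙 B) (hom f g)) (β : Cell (𝟙 B) Q (𝟙 C) (hom g h)) :
    ofHom (gcomp (Cells.pair α β rfl) (homMul f g h)) = mul (ofHom α) (ofHom β) rfl := by
  rw [ofHom_gcomp]
  unfold homMul
  rw [ofHom_toHom]
  exact paste_mul (Cells.single α) (Cells.single β) (cart f g) (cart g h) _ _ _

/-! ### Relative monads and relative adjunctions -/

/-- A relative monad with root `j`. -/
structure RelMonad {A E : X} (j : A ⟶ E) where
  carrier : A ⟶ E
  /-- The extension operator `E(j, t) ⇒ E(t, t)`. -/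
  ext : Cell (𝟙 A) (.single (hom j carrier)) (𝟙 A) (hom carrier carrier)
  /-- The unit `j ⇒ t`. -/
  unit : TightCell₂ j carrier
  unit_then_ext : gcomp (Cells.single (toHom unit)) ext = toHom (idGr carrier)
  unit_mul_ext :
    gcomp (Cells.pair (toHom unit) ext rfl) (homMul j carrier carrier) = idCell (hom j carrier)
  ext_mul_ext :
    gcomp (Cells.pair ext ext rfl) (homMul carrier carrier carrier) =
      gcomp (Cells.single (gcomp (Cells.pair (idCell (hom j carrier)) ext rfl)
        (homMul j carrier carrier))) ext

/-- A left `j`-relative adjoint of the tight-cell `r`: a tight-cell `ℓ` together with an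
isomorphism `C(ℓ, 1) ≅ E(j, r)`. -/
structure LeftRelAdjoint {A C E : X} (j : A ⟶ E) (r : C ⟶ E) where
  left : A ⟶ C
  sharp : Cell (𝟙 A) (.single (hom left (𝟙 C))) (𝟙 C) (hom j r)
  flat : Cell (𝟙 A) (.single (hom j r)) (𝟙 C) (hom left (𝟙 C))
  sharp_flat : gcomp (Cells.single sharp) flat = idCell (hom left (𝟙 C))
  flat_sharp : gcomp (Cells.single flat) sharp = idCell (hom j r)

namespace LeftRelAdjoint

variable {A C E : X} {j : A ⟶ E} {r : C ⟶ E} (adj : LeftRelAdjoint j r)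

/-- The 2-cell `E(j, y ≫ r) ≅ C(ℓ, y) ⇒ E(ℓ ≫ r, y ≫ r)`, given by right-transposition followed by
the action of `r`. -/
noncomputable def ext {D : X} (y : D ⟶ C) {e : D ⟶ E} (he : y ≫ r = e) :
    Cell (𝟙 A) (.single (hom j e)) (𝟙 D) (hom (adj.left ≫ r) e) :=
  toHom (whisker (act adj.flat y he (Category.comp_id y) (cart j e)) r rfl he)

theorem paste_ext {D : X} (y : D ⟶ C) {e : D ⟶ E} (he : y ≫ r = e) {P : Chain A D}
    (a : Cell (𝟙 A) P (𝟙 D) (hom j e)) :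
    ofHom (gcomp (Cells.single a) (adj.ext y he)) =
      whisker (act adj.flat y he (Category.comp_id y) (ofHom a)) r rfl he := by
  rw [ofHom_gcomp]
  unfold ext
  rw [ofHom_toHom, paste_whisker (hx₂ := Category.id_comp _) (hy₂ := Category.id_comp _)
    (hx₄ := rfl) (hy₄ := he), paste_act' (hk := Category.id_comp y) (h₃ := he)
    (h₄ := Category.comp_id y) (hg₃ := Category.id_comp e)]

/-- The unit `j ⇒ ℓ ≫ r`, the left-transpose of the identity. -/
noncomputable def unit : TightCell₂ j (adj.left ≫ r) :=
  act adj.sharp adj.left (Category.comp_id _) rfl (idGr adj.left)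

theorem act_flat_sharp {D : X} (y : D ⟶ C) {e : D ⟶ E} (he : y ≫ r = e) {P : Chain A D}
    (a : Gr adj.left P y) :
    act adj.flat y he (Category.comp_id y) (act adj.sharp y (Category.comp_id y) he a) = a := by
  rw [act_act, adj.sharp_flat, act_id]

theorem act_sharp_flat {D : X} (y : D ⟶ C) {e : D ⟶ E} (he : y ≫ r = e) {P : Chain A D}
    (a : Gr j P e) :
    act adj.sharp y (Category.comp_id y) he (act adj.flat y he (Category.comp_id y) a) = a := by
  rw [act_act, adj.flat_sharp, act_id]

theorem whisker_id {D D' C : X} {x : D ⟶ C} {y : D' ⟶ C} {P : Chain D D'} (a : Gr x P y) :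
    whisker a (𝟙 C) (Category.comp_id x) (Category.comp_id y) = a := by
  have h : tightUnit (𝟙 C) = idCell (VirtualEquipment.unit C) := by
    refine (exists_tightUnit (𝟙 C)).unique (tightUnit_spec (𝟙 C)) ?_
    exact (paste_id (unitCell C)).trans (id_paste (unitCell C)).symm
  unfold whisker
  rw [h]
  exact paste_id a

theorem sharp_mul {D D' : X} {y : D ⟶ C} {e : D ⟶ E} (he : y ≫ r = e) {P : Chain A D}
    (a : Gr adj.left P y) {m : D' ⟶ C} {e' : D' ⟶ E} (he' : m ≫ r = e') {Q : Chain D D'}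
    {S : Chain A D'} (b : Gr y Q m) (hS : P.append Q = S) :
    act adj.sharp m (Category.comp_id m) he' (mul a b hS) =
      mul (act adj.sharp y (Category.comp_id y) he a) (whisker b r he he') hS := by
  have h := act_mul adj.sharp y (Category.comp_id y) he a b hS (Category.comp_id m) he'
  rwa [whisker_id] at h

theorem flat_mul {D D' : X} {y : D ⟶ C} {e : D ⟶ E} (he : y ≫ r = e) {P : Chain A D}
    (a : Gr j P e) {m : D' ⟶ C} {e' : D' ⟶ E} (he' : m ≫ r = e') {Q : Chain D D'}
    {S : Chain A D'} (b : Gr y Q m) (hS : P.append Q = S) :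
    act adj.flat m he' (Category.comp_id m) (mul a (whisker b r he he') hS) =
      mul (act adj.flat y he (Category.comp_id y) a) b hS := by
  have h := act_mul adj.flat y he (Category.comp_id y) a b hS he' (Category.comp_id m)
  rwa [whisker_id] at h

theorem unit_mul_ext {D : X} (y : D ⟶ C) {e : D ⟶ E} (he : y ≫ r = e) :
    gcomp (Cells.pair (toHom adj.unit) (adj.ext y he) rfl) (homMul j (adj.left ≫ r) e) =
      idCell (hom j e) := by
  refine hom_ext (hf := Category.id_comp j) (hg := Category.id_comp e) ?_
  refine (ofHom_homMul _ _).trans ?_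
  unfold ext
  rw [ofHom_toHom, ofHom_toHom]
  unfold unit
  rw [← sharp_mul adj rfl (idGr adj.left) he, id_mul]
  exact (act_sharp_flat adj y he (cart j e)).trans (id_paste (cart j e)).symm

theorem ext_mul_ext {D : X} (y : D ⟶ C) {e : D ⟶ E} (he : y ≫ r = e) :
    gcomp (Cells.pair (adj.ext adj.left rfl) (adj.ext y he) rfl)
        (homMul (adj.left ≫ r) (adj.left ≫ r) e) =
      gcomp (Cells.single (gcomp (Cells.pair (idCell (hom j (adj.left ≫ r))) (adj.ext y he) rfl)
        (homMul j (adj.left ≫ r) e))) (adj.ext y he) := by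
  refine hom_ext (hf := Category.id_comp _) (hg := Category.id_comp e) ?_
  refine (ofHom_homMul _ _).trans ?_
  refine Eq.trans ?_ (paste_ext adj y he _).symm
  have h : ofHom (idCell (hom j (adj.left ≫ r))) = cart j (adj.left ≫ r) := id_paste (cart j _)
  rw [ofHom_homMul, h]
  unfold ext
  rw [ofHom_toHom, ofHom_toHom, flat_mul, whisker_mul]

/-- The relative monad induced by a relative adjunction. -/
noncomputable def monad : RelMonad j where
  carrier := adj.left ≫ r
  ext := adj.ext adj.left rfl
  unit := adj.unit
  unit_then_ext := by
    refine hom_ext (hf := Category.id_comp _) (hg := Category.id_comp _) ?_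
    refine (paste_ext adj adj.left rfl _).trans ?_
    refine Eq.trans ?_ (ofHom_toHom _).symm
    rw [ofHom_toHom]
    unfold unit
    rw [act_flat_sharp]
    exact whisker_idGr _ _ _
  unit_mul_ext := adj.unit_mul_ext adj.left rfl
  ext_mul_ext := adj.ext_mul_ext adj.left rfl

end LeftRelAdjoint

/-! ### Algebras and algebra objects -/

/-- An algebra with domain `D` for a relative monad. -/
structure RelMonad.Alg {A E : X} {j : A ⟶ E} (T : RelMonad j) (D : X) where
  carrier : D ⟶ E
  /-- The extension operator `E(j, e) ⇒ E(t, e)`. -/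
  ext : Cell (𝟙 A) (.single (hom j carrier)) (𝟙 D) (hom T.carrier carrier)
  unit_mul_ext :
    gcomp (Cells.pair (toHom T.unit) ext rfl) (homMul j T.carrier carrier) =
      idCell (hom j carrier)
  ext_mul_ext :
    gcomp (Cells.pair T.ext ext rfl) (homMul T.carrier T.carrier carrier) =
      gcomp (Cells.single (gcomp (Cells.pair (idCell (hom j T.carrier)) ext rfl)
        (homMul j T.carrier carrier))) ext

namespace RelMonad

variable {A E : X} {j : A ⟶ E} {T : RelMonad j}

/-- A 2-cell `p₁, …, pₙ ⇒ E(e, e')` is a graded algebra morphism when the two induced 2-cells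
`E(j, e), p₁, …, pₙ ⇒ E(t, e')` agree. -/
def IsAlgHom {D D' : X} (a : T.Alg D) (a' : T.Alg D') {P : Chain D D'}
    (ε : Cell (𝟙 D) P (𝟙 D') (hom a.carrier a'.carrier)) : Prop :=
  gcomp (Cells.single (gcomp (Cells.pair (idCell (hom j a.carrier)) ε rfl)
      (homMul j a.carrier a'.carrier))) a'.ext =
    gcomp (Cells.pair a.ext ε rfl) (homMul T.carrier a.carrier a'.carrier)

/-- The restriction of the algebra `m` along the tight-cell `c` is the algebra `a`. -/
structure RestrictsTo {M D : X} (m : T.Alg M) (c : D ⟶ M) (a : T.Alg D) : Prop where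
  carrier_eq : c ≫ m.carrier = a.carrier
  ext_eq : restrictRight m.ext c carrier_eq carrier_eq = a.ext

/-- An algebra object for a relative monad: a universal algebra, with respect both to algebras and
to graded algebra morphisms. -/
structure AlgebraObject (T : RelMonad j) where
  obj : X
  alg : T.Alg obj
  existsUnique_tight : ∀ {D : X} (a : T.Alg D), ∃! c : D ⟶ obj, RestrictsTo alg c a
  existsUnique_cell : ∀ {D D' : X} (a : T.Alg D) (a' : T.Alg D') (c : D ⟶ obj) (c' : D' ⟶ obj)
    (hc : RestrictsTo alg c a) (hc' : RestrictsTo alg c' a') (P : Chain D D')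
    (ε : Cell (𝟙 D) P (𝟙 D') (hom a.carrier a'.carrier)), IsAlgHom a a' ε →
    ∃! ε' : Cell (𝟙 D) P (𝟙 D') (hom c c'),
      toHom (whisker (ofHom ε') alg.carrier hc.carrier_eq hc'.carrier_eq) = ε

/-- The forgetful tight-cell `u_T : Alg(T) ⟶ E`. -/
abbrev AlgebraObject.forget (M : AlgebraObject T) : M.obj ⟶ E := M.alg.carrier

end RelMonad

/-- The right adjoint of a relative adjunction is an algebra for the induced relative monad. -/
noncomputable def LeftRelAdjoint.alg {A C E : X} {j : A ⟶ E} {r : C ⟶ E}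
    (adj : LeftRelAdjoint j r) : adj.monad.Alg C where
  carrier := r
  ext := adj.ext (𝟙 C) (Category.id_comp r)
  unit_mul_ext := adj.unit_mul_ext (𝟙 C) (Category.id_comp r)
  ext_mul_ext := adj.ext_mul_ext (𝟙 C) (Category.id_comp r)

/-- The comparison tight-cell to an algebra object for the induced relative monad. -/
noncomputable def LeftRelAdjoint.comparison {A C E : X} {j : A ⟶ E} {r : C ⟶ E}
    (adj : LeftRelAdjoint j r) (M : adj.monad.AlgebraObject) : C ⟶ M.obj :=
  (M.existsUnique_tight adj.alg).choose

theorem LeftRelAdjoint.comparison_restrictsTo {A C E : X} {j : A ⟶ E} {r : C ⟶ E}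
    (adj : LeftRelAdjoint j r) (M : adj.monad.AlgebraObject) :
    RelMonad.RestrictsTo M.alg (adj.comparison M) adj.alg :=
  (M.existsUnique_tight adj.alg).choose_spec.1

/-! ### Density and monadicity -/

/-- The `p`-cocone `(c, μ)` for `f` is a `p`-weighted colimit of `f`. -/
def IsWeightedColimit {Y Z W : X} (p : Loose Z Y) (f : Z ⟶ W) (c : Y ⟶ W)
    (μ : Cell (𝟙 Z) (.single p) (𝟙 Y) (hom f c)) : Prop :=
  ∀ Q : Chain Y W, Function.Bijective
    (fun ψ : Cell (𝟙 Y) Q (𝟙 W) (hom c (𝟙 W)) =>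
      (gcomp (Cells.pair μ ψ rfl) (homMul f c (𝟙 W)) : Cell (𝟙 Z) (.cons p Q) (𝟙 W)
        (hom f (𝟙 W))))

/-- A tight-cell `j : A ⟶ E` is dense when the identity of `E` is, by means of the identity 2-cell,
the (pointwise) left extension of `j` along itself, that is, the colimit of `j` weighted by
`E(j, 1)`. -/
def IsDense {A E : X} (j : A ⟶ E) : Prop :=
  IsWeightedColimit (hom j (𝟙 E)) j (𝟙 E) (idCell (hom j (𝟙 E)))

/-- Isomorphism of parallel tight-cells. -/
def TightIso {A E : X} (f g : A ⟶ E) : Prop :=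
  ∃ (α : TightCell₂ f g) (β : TightCell₂ g f), mul α β rfl = idGr f ∧ mul β α rfl = idGr g

/-- Equivalences in the 2-category of objects, tight-cells and 2-cells. -/
def IsTightEquivalence {C D : X} (c : C ⟶ D) : Prop :=
  ∃ d : D ⟶ C, TightIso (c ≫ d) (𝟙 C) ∧ TightIso (d ≫ c) (𝟙 D)

/-- `r` is strictly `j`-monadic: it has a left `j`-adjoint, the induced `j`-monad has an algebra
object, and the comparison tight-cell is an isomorphism. -/
def IsStrictlyMonadic {A D E : X} (j : A ⟶ E) (r : D ⟶ E) : Prop :=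
  ∃ (adj : LeftRelAdjoint j r) (M : adj.monad.AlgebraObject), IsIso (adj.comparison M)

/-- `r` is non-strictly `j`-monadic: it has a left `j`-adjoint, the induced `j`-monad has an algebra
object, and the comparison tight-cell is an equivalence. -/
def IsNonstrictlyMonadic {A D E : X} (j : A ⟶ E) (r : D ⟶ E) : Prop :=
  ∃ (adj : LeftRelAdjoint j r) (M : adj.monad.AlgebraObject),
    IsTightEquivalence (adj.comparison M)

end

end RelMonadicity

/-! Let τ be a T-algebra with carrier r : D → E', and let ℓ' be a left j'-adjoint of r, with unit η'
and induced j'-monad T', of carrier ℓ' ; r. Every T'-algebra a carries a T-algebra structure.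
Extending η', restricted along j, by the structure of τ gives a 2-cell t ⇒ j ; ℓ' ; r (`monadMap`),
and the T-extension for a is this 2-cell followed by the T'-extension restricted along j
(`transfer`). Transfer commutes with restriction and sends the canonical T'-algebra on r back to τ.
So the universal T'-algebra induces d : Alg(T') → Alg(T), and uniqueness of classifying tight-cells
shows that the comparison followed by d is the tight-cell c : D → Alg(T) classifying τ.

For the other composite, the T'-structure has to be recovered from the transferred T-structure; this
is `bact_mul_whisker_iso`. The extension of a graded 2-cell x from j' to a is a graded 2-cell w from
ℓ' ; r to a, and associativity of a makes w a morphism of T-algebras (`isAlgHom_transfer`), so w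
lifts to Alg(T). When c is full and the transfer of a is classified by a tight-cell isomorphic to y
; c, the lift comes, up to that isomorphism, from a 2-cell g from ℓ' to y. The unit law of a says
that η' followed by w is x, so g must be the transpose of x. Hence extension in a is transposition
followed by r, which is extension in the canonical algebra on r.

In the strict case c is an identity, and d is inverse to the comparison. In the non-strict case c
has a pseudo-inverse c', and d ; c' is a pseudo-inverse of the comparison: the isomorphism of
carriers is one of T'-algebras and lifts to Alg(T').

Calculations are made with graded 2-cells (`Gr`) as generalised elements: a globular 2-cell E(f, g)
⇒ E'(f', g') is treated as an operation `bact`, natural under pasting and determined by its value at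
`cart`. -/

namespace RelMonadicity

open CellData CellOps VirtualDoubleCategory VirtualEquipment

section

variable {X : Type u} [VirtualEquipment.{u, v, w, z} X]

/-! ### Composition and whiskering of graded 2-cells -/

/-- The generic case of associativity. By the universal property of the leftmost loose-identity it
suffices to insert its unit, after which both sides reduce to `unitMul E`. -/
theorem mul_idCell_unitMul (E : X) :
    mul (unitMul E) (idCell (unit E)) rfl = mul (idCell (unit E)) (unitMul E) rfl := by
  have h₀ : mul (idCell (unit E)) (idCell (unit E)) rfl = unitMul E := id_paste (unitMul E)
  have e : idGr (𝟙 E) = unitCell E := id_paste (unitCell E)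
  refine (unit_existsUnique (.nil E) (.cons (unit E) (.single (unit E))) (unitMul E)).unique ?_ ?_
  · refine (paste_mul (Cells.cons (unitCell E) (Cells.single (idCell (unit E))) rfl)
      (Cells.single (idCell (unit E))) (unitMul E) (idCell (unit E)) (Category.id_comp _)
      (Category.id_comp _) (Category.id_comp _)).trans ?_
    rw [unitMul_spec, paste_id]
    exact h₀
  · refine (paste_mul (Cells.single (unitCell E)) (idCells (.cons (unit E) (.single (unit E))))
      (idCell (unit E)) (unitMul E) (Category.id_comp _)
      (Category.id_comp _) (Category.id_comp _)).trans ?_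
    rw [paste_id, id_paste, ← e]
    exact id_mul _

/-- Both bracketings are the row α, β, γ pasted onto one of the two sides of `mul_idCell_unitMul`.
-/
theorem mul_assoc {A B C D E : X} {f : A ⟶ E} {g : B ⟶ E} {h : C ⟶ E} {k : D ⟶ E}
    {P : Chain A B} {Q : Chain B C} {R : Chain C D} {S₁ : Chain A C} {S₂ : Chain B D}
    {S : Chain A D} (α : Gr f P g) (β : Gr g Q h) (γ : Gr h R k) (h₁ : P.append Q = S₁)
    (h₂ : S₁.append R = S) (h₃ : Q.append R = S₂) (h₄ : P.append S₂ = S) :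
    mul (mul α β h₁) γ h₂ = mul α (mul β γ h₃) h₄ := by
  subst h₁ h₂ h₃
  let Θ := Cells.cons α (Cells.cons β (Cells.single γ) rfl) h₄
  have hl := paste_assoc (VComp.cons_heq Θ (Cells.pair α β rfl) (Cells.single γ) (unitMul E)
    (Cells.single (idCell (unit E))) _ (Category.comp_id f) (Category.comp_id h) rfl rfl HEq.rfl
    (VComp.single (Cells.single γ) (idCell (unit E)) (Category.comp_id h) (Category.comp_id k)))
    (unitMul E) (Category.comp_id _) (Category.comp_id _) (Category.comp_id f)
    (Category.comp_id k) (Category.comp_id f) (Category.comp_id k)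
  have hr := paste_assoc (VComp.cons_heq Θ (Cells.single α) (Cells.pair β γ rfl)
    (idCell (unit E)) (Cells.single (unitMul E)) _ (Category.comp_id f) (Category.comp_id g) h₄
    rfl (Cells.cons_heq α h₄ rfl rfl rfl HEq.rfl)
    (VComp.single (Cells.pair β γ rfl) (unitMul E) (Category.comp_id g) (Category.comp_id k)))
    (unitMul E) (Category.comp_id _) (Category.comp_id _) (Category.comp_id f)
    (Category.comp_id k) (Category.comp_id f) (Category.comp_id k)
  rw [paste_id] at hl hr
  refine hl.symm.trans (Eq.trans ?_ hr)
  exact congrArg (fun x => paste Θ x (Category.comp_id f) (Category.comp_id k))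
    (mul_idCell_unitMul E)

/-- Restriction of a 2-cell between parallel tight-cells along a tight-cell. -/
def precomp {A B E : X} (l : A ⟶ B) {f g : B ⟶ E} {f' g' : A ⟶ E} (hf : l ≫ f = f')
    (hg : l ≫ g = g') (α : TightCell₂ f g) : TightCell₂ f' g' :=
  paste (.nil l) α hf hg

theorem precomp_mul {A B E : X} (l : A ⟶ B) {f g h : B ⟶ E} {f' g' h' : A ⟶ E} (hf : l ≫ f = f')
    (hg : l ≫ g = g') (hh : l ≫ h = h') (α : TightCell₂ f g) (β : TightCell₂ g h) :
    precomp l hf hh (mul α β rfl) = mul (precomp l hf hg α) (precomp l hg hh β) rfl :=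
  paste_mul (.nil l) (.nil l) α β hf hg hh

theorem precomp_idGr {A B E : X} (l : A ⟶ B) {f : B ⟶ E} {f' : A ⟶ E} (hf : l ≫ f = f') :
    precomp l hf hf (idGr f) = idGr f' :=
  paste_assoc (VComp.nil l f f' hf) (unitCell E) (Category.comp_id f) (Category.comp_id f)
    hf hf (Category.comp_id f') (Category.comp_id f')

theorem precomp_id {A E : X} {f g : A ⟶ E} (α : TightCell₂ f g) :
    precomp (𝟙 A) (Category.id_comp f) (Category.id_comp g) α = α :=
  id_paste α

theorem tightUnit_comp {B C E : X} (r : B ⟶ C) (s : C ⟶ E) {t : B ⟶ E} (h : r ≫ s = t) :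
    tightUnit t = whisker (tightUnit r) s h h := by
  refine (exists_tightUnit t).unique (tightUnit_spec t) ?_
  refine (paste_whisker (Cells.single (unitCell B)) (tightUnit r) s h h (Category.id_comp r)
    (Category.id_comp r) (Category.id_comp t) (Category.id_comp t) h h).trans ?_
  rw [tightUnit_spec]
  exact whisker_idGr r s h

theorem whisker_whisker {A A' B C E : X} {f : A ⟶ B} {g : A' ⟶ B} {P : Chain A A'}
    (α : Gr f P g) (r : B ⟶ C) (s : C ⟶ E) {t : B ⟶ E} (h : r ≫ s = t) {f₁ : A ⟶ C}
    {g₁ : A' ⟶ C} {f₂ : A ⟶ E} {g₂ : A' ⟶ E} (hf₁ : f ≫ r = f₁) (hg₁ : g ≫ r = g₁)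
    (hf₂ : f₁ ≫ s = f₂) (hg₂ : g₁ ≫ s = g₂) (hf₃ : f ≫ t = f₂) (hg₃ : g ≫ t = g₂) :
    whisker (whisker α r hf₁ hg₁) s hf₂ hg₂ = whisker α t hf₃ hg₃ := by
  rw [whisker.eq_1 α t, tightUnit_comp r s h]
  exact (paste_whisker (Cells.single α) (tightUnit r) s h h hf₁ hg₁ hf₃ hg₃ hf₂ hg₂).symm

/-- The generic case of `whisker_naturality`: both sides become κ once the unit of C is inserted. -/
theorem tightUnit_mul_cell {C E : X} {r s : C ⟶ E} (κ : TightCell₂ r s) :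
    mul (tightUnit r) κ rfl = mul κ (tightUnit s) rfl := by
  refine (unit_existsUnique (.nil C) (.nil C) κ).unique ?_ ?_
  · refine (paste_mul (Cells.single (unitCell C)) (.nil (𝟙 C)) (tightUnit r) κ
      (Category.id_comp r) (Category.id_comp r) (Category.id_comp s)).trans ?_
    rw [tightUnit_spec]
    exact (id_mul _).trans (precomp_id κ)
  · refine (paste_mul (.nil (𝟙 C)) (Cells.single (unitCell C)) κ (tightUnit s)
      (Category.id_comp r) (Category.id_comp s) (Category.id_comp s)).trans ?_
    rw [tightUnit_spec]
    exact (mul_id _).trans (precomp_id κ)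

/-- Whiskering is natural with respect to 2-cells between tight-cells. -/
theorem whisker_naturality {A B C E : X} {f : A ⟶ C} {g : B ⟶ C} {P : Chain A B} (α : Gr f P g)
    {r s : C ⟶ E} (κ : TightCell₂ r s) {f₁ : A ⟶ E} {g₁ : B ⟶ E} {f₂ : A ⟶ E} {g₂ : B ⟶ E}
    (hf₁ : f ≫ r = f₁) (hg₁ : g ≫ r = g₁) (hf₂ : f ≫ s = f₂) (hg₂ : g ≫ s = g₂) :
    mul (whisker α r hf₁ hg₁) (precomp g hg₁ hg₂ κ) P.append_nil =
      mul (precomp f hf₁ hf₂ κ) (whisker α s hf₂ hg₂) rfl := by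
  have hl := paste_assoc (VComp.cons_heq (Cells.single α) (Cells.single α) (.nil g) (tightUnit r)
    (Cells.single κ) _ hf₁ hg₁ P.append_nil rfl (Cells.append_nil_heq _).symm
    (VComp.single (.nil g) κ hg₁ hg₂)) (unitMul E) (Category.comp_id _) (Category.comp_id _)
    hf₁ hg₂ (Category.comp_id _) (Category.comp_id _)
  have hr := paste_mul (.nil f) (Cells.single α) κ (tightUnit s) hf₁ hf₂ hg₂
  refine hl.symm.trans (Eq.trans ?_ hr)
  exact congrArg (fun x => paste (Cells.single α) x hf₁ hg₂) (tightUnit_mul_cell κ)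

/-! ### The action of globular 2-cells on both sides -/

/-- The action on graded 2-cells, by composition, of a globular 2-cell
`φ : E(f, g) ⇒ E'(f', g')` restricted along `l` on the left and `k` on the right. -/
noncomputable def bact {A B C D E E' : X} {f : A ⟶ E} {g : B ⟶ E} {f' : A ⟶ E'} {g' : B ⟶ E'}
    (φ : Cell (𝟙 A) (.single (hom f g)) (𝟙 B) (hom f' g')) (l : C ⟶ A) (k : D ⟶ B)
    {f₁ : C ⟶ E} {g₁ : D ⟶ E} {f₂ : C ⟶ E'} {g₂ : D ⟶ E'} (hf₁ : l ≫ f = f₁) (hg₁ : k ≫ g = g₁)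
    (hf₂ : l ≫ f' = f₂) (hg₂ : k ≫ g' = g₂) {P : Chain C D} (a : Gr f₁ P g₁) : Gr f₂ P g₂ :=
  paste (Cells.single (lift a hf₁ hg₁)) (ofHom φ) hf₂ hg₂

section

variable {A B C D E E' : X} {f : A ⟶ E} {g : B ⟶ E} {f' : A ⟶ E'} {g' : B ⟶ E'}

theorem act_eq_bact (φ : Cell (𝟙 A) (.single (hom f g)) (𝟙 B) (hom f' g')) (k : D ⟶ B)
    {P : Chain A D} {g₁ : D ⟶ E} {g₂ : D ⟶ E'} (h₁ : k ≫ g = g₁) (h₂ : k ≫ g' = g₂)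
    (a : Gr f P g₁) :
    act φ k h₁ h₂ a = bact φ (𝟙 A) k (Category.id_comp f) h₁ (Category.id_comp f') h₂ a :=
  rfl

theorem paste_lift {C' D' : X} {l : C ⟶ A} {k : D ⟶ B} {l' : C' ⟶ A} {k' : D' ⟶ B}
    {f₁ : C ⟶ E} {g₁ : D ⟶ E} {f₃ : C' ⟶ E} {g₃ : D' ⟶ E} {P : Chain C D} {Q : Chain C' D'}
    {p : C' ⟶ C} {q : D' ⟶ D} (Φ : Cells p Q q P) (a : Gr f₁ P g₁) (hf₁ : l ≫ f = f₁)
    (hg₁ : k ≫ g = g₁) (hp : p ≫ l = l') (hq : q ≫ k = k') (hf₃ : p ≫ f₁ = f₃)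
    (hg₃ : q ≫ g₁ = g₃) (hf₄ : l' ≫ f = f₃) (hg₄ : k' ≫ g = g₃) :
    paste Φ (lift a hf₁ hg₁) hp hq = lift (paste Φ a hf₃ hg₃) hf₄ hg₄ := by
  apply lift_uniq
  refine (paste_single Φ (lift a hf₁ hg₁) (cart f g) hp hq hf₁ hg₁ hf₃ hg₃ hf₄ hg₄).symm.trans ?_
  rw [lift_cart]

theorem paste_bact {C' D' : X} (φ : Cell (𝟙 A) (.single (hom f g)) (𝟙 B) (hom f' g'))
    {l : C ⟶ A} {k : D ⟶ B} {l' : C' ⟶ A} {k' : D' ⟶ B}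
    {f₁ : C ⟶ E} {g₁ : D ⟶ E} {f₂ : C ⟶ E'} {g₂ : D ⟶ E'} {f₃ : C' ⟶ E} {g₃ : D' ⟶ E}
    {f₄ : C' ⟶ E'} {g₄ : D' ⟶ E'} {P : Chain C D} {Q : Chain C' D'} {p : C' ⟶ C} {q : D' ⟶ D}
    (Φ : Cells p Q q P) (a : Gr f₁ P g₁) (hf₁ : l ≫ f = f₁) (hg₁ : k ≫ g = g₁)
    (hf₂ : l ≫ f' = f₂) (hg₂ : k ≫ g' = g₂) (hp : p ≫ l = l') (hq : q ≫ k = k')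
    (hf₃ : p ≫ f₁ = f₃) (hg₃ : q ≫ g₁ = g₃) (hf₄ : p ≫ f₂ = f₄) (hg₄ : q ≫ g₂ = g₄)
    (hf₅ : l' ≫ f = f₃) (hg₅ : k' ≫ g = g₃) (hf₆ : l' ≫ f' = f₄) (hg₆ : k' ≫ g' = g₄) :
    paste Φ (bact φ l k hf₁ hg₁ hf₂ hg₂ a) hf₄ hg₄ =
      bact φ l' k' hf₅ hg₅ hf₆ hg₆ (paste Φ a hf₃ hg₃) := by
  refine (paste_single Φ (lift a hf₁ hg₁) (ofHom φ) hp hq hf₂ hg₂ hf₄ hg₄ hf₆ hg₆).trans ?_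
  rw [paste_lift Φ a hf₁ hg₁ hp hq hf₃ hg₃ hf₅ hg₅]
  rfl

theorem bact_cart (φ : Cell (𝟙 A) (.single (hom f g)) (𝟙 B) (hom f' g')) :
    bact φ (𝟙 A) (𝟙 B) (Category.id_comp f) (Category.id_comp g) (Category.id_comp f')
      (Category.id_comp g') (cart f g) = ofHom φ :=
  act_cart φ

/-- A bilateral action is determined by the action on the cartesian 2-cell. -/
theorem bact_eq_paste_bact_cart (φ : Cell (𝟙 A) (.single (hom f g)) (𝟙 B) (hom f' g'))
    (l : C ⟶ A) (k : D ⟶ B) {f₁ : C ⟶ E} {g₁ : D ⟶ E} {f₂ : C ⟶ E'} {g₂ : D ⟶ E'}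
    {C₀ D₀ : X} (l₀ : C₀ ⟶ A) (k₀ : D₀ ⟶ B) {f₀ : C₀ ⟶ E} {g₀ : D₀ ⟶ E} {f₀' : C₀ ⟶ E'}
    {g₀' : D₀ ⟶ E'} (p : C ⟶ C₀) (q : D ⟶ D₀)
    (hf₀ : l₀ ≫ f = f₀) (hg₀ : k₀ ≫ g = g₀) (hf₀' : l₀ ≫ f' = f₀') (hg₀' : k₀ ≫ g' = g₀')
    (hf₁ : l ≫ f = f₁) (hg₁ : k ≫ g = g₁)
    (hf₂ : l ≫ f' = f₂) (hg₂ : k ≫ g' = g₂) (hp : p ≫ l₀ = l) (hq : q ≫ k₀ = k)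
    (hf₃ : p ≫ f₀ = f₁) (hg₃ : q ≫ g₀ = g₁) (hf₄ : p ≫ f₀' = f₂) (hg₄ : q ≫ g₀' = g₂)
    {P : Chain C D} (a : Gr f₁ P g₁) :
    bact φ l k hf₁ hg₁ hf₂ hg₂ a =
      paste (Cells.single (lift a hf₃ hg₃))
        (bact φ l₀ k₀ hf₀ hg₀ hf₀' hg₀' (cart f₀ g₀)) hf₄ hg₄ := by
  rw [paste_bact φ _ _ _ _ _ _ hp hq hf₃ hg₃ _ _ hf₁ hg₁ hf₂ hg₂, lift_cart]

theorem bact_bact {E'' : X} {f'' : A ⟶ E''} {g'' : B ⟶ E''}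
    (φ : Cell (𝟙 A) (.single (hom f g)) (𝟙 B) (hom f' g'))
    (ψ : Cell (𝟙 A) (.single (hom f' g')) (𝟙 B) (hom f'' g'')) (l : C ⟶ A) (k : D ⟶ B)
    {f₁ : C ⟶ E} {g₁ : D ⟶ E} {f₂ : C ⟶ E'} {g₂ : D ⟶ E'} {f₃ : C ⟶ E''} {g₃ : D ⟶ E''}
    (hf₁ : l ≫ f = f₁) (hg₁ : k ≫ g = g₁) (hf₂ : l ≫ f' = f₂) (hg₂ : k ≫ g' = g₂)
    (hf₃ : l ≫ f'' = f₃) (hg₃ : k ≫ g'' = g₃) {P : Chain C D} (a : Gr f₁ P g₁) :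
    bact ψ l k hf₂ hg₂ hf₃ hg₃ (bact φ l k hf₁ hg₁ hf₂ hg₂ a) =
      bact (gcomp (Cells.single φ) ψ) l k hf₁ hg₁ hf₃ hg₃ a := by
  unfold bact
  have h : lift (paste (Cells.single (lift a hf₁ hg₁)) (ofHom φ) hf₂ hg₂) hf₂ hg₂ =
      paste (Cells.single (lift a hf₁ hg₁)) φ (Category.comp_id l) (Category.comp_id k) :=
    (lift_uniq (paste_single _ φ (cart f' g') _ _ _ _ _ _ _ _).symm).symm
  rw [h, ofHom_gcomp]
  exact (paste_single _ φ (ofHom ψ) _ _ _ _ _ _ _ _).symm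

theorem bact_id (l : C ⟶ A) (k : D ⟶ B) {f₁ : C ⟶ E} {g₁ : D ⟶ E} (hf₁ : l ≫ f = f₁)
    (hg₁ : k ≫ g = g₁) {P : Chain C D} (a : Gr f₁ P g₁) :
    bact (idCell (hom f g)) l k hf₁ hg₁ hf₁ hg₁ a = a := by
  have h : ofHom (idCell (hom f g)) = cart f g := id_paste (cart f g)
  unfold bact
  rw [h]
  exact lift_cart a hf₁ hg₁

/-- The bilateral action is natural with respect to composition on the right. -/
theorem bact_mul_whisker (φ : Cell (𝟙 A) (.single (hom f g)) (𝟙 B) (hom f' g')) (l : C ⟶ A)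
    (k : D ⟶ B) {f₁ : C ⟶ E} {g₁ : D ⟶ E} {f₂ : C ⟶ E'} {g₂ : D ⟶ E'}
    (hf₁ : l ≫ f = f₁) (hg₁ : k ≫ g = g₁) (hf₂ : l ≫ f' = f₂) (hg₂ : k ≫ g' = g₂)
    {D' : X} {P : Chain C D} {Q : Chain D D'} {S : Chain C D'} (a : Gr f₁ P g₁)
    {m : D' ⟶ B} (b : Gr k Q m) (hS : P.append Q = S) {g₃ : D' ⟶ E} {g₄ : D' ⟶ E'}
    (hg₃ : m ≫ g = g₃) (hg₄ : m ≫ g' = g₄) :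
    bact φ l m hf₁ hg₃ hf₂ hg₄ (mul a (whisker b g hg₁ hg₃) hS) =
      mul (bact φ l k hf₁ hg₁ hf₂ hg₂ a) (whisker b g' hg₂ hg₄) hS := by
  subst hS
  -- The composite is pasted from the generic composite of `cart f g` with the action of g, for
  -- which the claim is `act_mul_tightUnit`.
  have e : mul a (whisker b g hg₁ hg₃) rfl =
      paste ((Cells.single (lift a hf₁ hg₁)).append (Cells.single b))
        (mul (cart f g) (tightUnit g) rfl) hf₁ hg₃ := by
    refine Eq.symm ((paste_mul _ _ (cart f g) (tightUnit g) hf₁ hg₁ hg₃).trans ?_)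
    rw [lift_cart]
    rfl
  rw [e]
  refine (paste_bact φ _ _ (Category.id_comp f) (Category.id_comp g) (Category.id_comp f')
    (Category.id_comp g') (Category.comp_id l) (Category.comp_id m) hf₁ hg₃ hf₂ hg₄ _ _ _
    _).symm.trans ?_
  rw [← act_eq_bact, act_mul_tightUnit, act_cart]
  exact paste_mul _ _ (ofHom φ) (tightUnit g') hf₂ hg₂ hg₄

end

theorem toHom_ofHom {A B E : X} {f : A ⟶ E} {P : Chain A B} {g : B ⟶ E}
    (φ : Cell (𝟙 A) P (𝟙 B) (hom f g)) : toHom (ofHom φ) = φ :=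
  (lift_uniq rfl).symm

/-! ### The laws of an algebra in terms of graded 2-cells -/

namespace RelMonad

variable {A E : X} {j : A ⟶ E} {T : RelMonad j}

namespace Alg

variable {B D D' D'' : X}

/-- The unit law is an equation at the cartesian 2-cell; pasting the lift of x onto it yields the
law for an arbitrary x. -/
theorem unit_mul_bact (a : T.Alg D) (l : B ⟶ A) (n : D' ⟶ D) {j₁ t₁ : B ⟶ E} {e₁ : D' ⟶ E}
    (hj : l ≫ j = j₁) (ht : l ≫ T.carrier = t₁) (he : n ≫ a.carrier = e₁) {P : Chain B D'}
    (x : Gr j₁ P e₁) :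
    mul (precomp l hj ht T.unit) (bact a.ext l n hj he ht he x) rfl = x := by
  have h := congrArg ofHom a.unit_mul_ext
  rw [ofHom_homMul, ofHom_toHom] at h
  have h₂ := congrArg (fun y => paste (Cells.single (lift x hj he)) y hj he) h
  refine Eq.trans ?_ (h₂.trans ?_)
  · exact (paste_mul (.nil l) (Cells.single (lift x hj he)) T.unit (ofHom a.ext) hj ht he).symm
  · have h₃ : ofHom (idCell (hom j a.carrier)) = cart j a.carrier := id_paste _
    exact (congrArg (fun y => paste (Cells.single (lift x hj he)) y hj he) h₃).trans
      (lift_cart x hj he)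

/-- The associativity law on generalised elements, obtained by pasting the lifts of x and y side by
side onto the law for the extension operators. -/
theorem bact_mul_bact (a : T.Alg D) (l : B ⟶ A) (m : D' ⟶ A) (n : D'' ⟶ D) {j₁ t₁ : B ⟶ E}
    {j₂ t₂ : D' ⟶ E} {e₁ : D'' ⟶ E} (hj₁ : l ≫ j = j₁) (ht₁ : l ≫ T.carrier = t₁)
    (hj₂ : m ≫ j = j₂) (ht₂ : m ≫ T.carrier = t₂) (he : n ≫ a.carrier = e₁) {P : Chain B D'}
    {Q : Chain D' D''} {S : Chain B D''} (x : Gr j₁ P t₂) (y : Gr j₂ Q e₁)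
    (hS : P.append Q = S) :
    bact a.ext l n hj₁ he ht₁ he (mul x (bact a.ext m n hj₂ he ht₂ he y) hS) =
      mul (bact T.ext l m hj₁ ht₂ ht₁ ht₂ x) (bact a.ext m n hj₂ he ht₂ he y) hS := by
  subst hS
  have h := congrArg ofHom a.ext_mul_ext
  have h₃ : ofHom (idCell (hom j T.carrier)) = cart j T.carrier := id_paste _
  have h₄ : gcomp (Cells.pair (idCell (hom j T.carrier)) a.ext rfl)
      (homMul j T.carrier a.carrier) = toHom (mul (cart j T.carrier) (ofHom a.ext) rfl) := by
    rw [← toHom_ofHom (gcomp _ _), ofHom_homMul, h₃]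
  rw [ofHom_homMul, h₄, ofHom_gcomp] at h
  have h₂ := congrArg (fun z => paste
    ((Cells.single (lift x hj₁ ht₂)).append (Cells.single (lift y hj₂ he))) z ht₁ he) h
  refine Eq.trans ?_ (h₂.symm.trans ?_)
  · refine Eq.trans ?_ (paste_single _ (toHom (mul (cart j T.carrier) (ofHom a.ext) rfl))
      (ofHom a.ext) (Category.comp_id l) (Category.comp_id n) _ _ _ _ ht₁ he).symm
    rw [paste_lift _ _ _ _ (Category.comp_id l) (Category.comp_id n) hj₁ he hj₁ he]
    have h₅ := paste_mul (Cells.single (lift x hj₁ ht₂)) (Cells.single (lift y hj₂ he))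
      (cart j T.carrier) (ofHom a.ext) hj₁ ht₂ he
    rw [h₅, lift_cart]
    rfl
  · exact paste_mul _ _ (ofHom T.ext) (ofHom a.ext) ht₁ ht₂ he

theorem bact_cart_mul_bact (a : T.Alg D) (n : D' ⟶ D) {e : D' ⟶ E} (he : n ≫ a.carrier = e)
    {Q : Chain A D'} {S : Chain A D'} {R : Chain A A} (x : Gr j R T.carrier) (y : Gr j Q e)
    (hS : R.append Q = S) :
    bact a.ext (𝟙 A) n (Category.id_comp _) he (Category.id_comp _) he
        (mul x (bact a.ext (𝟙 A) n (Category.id_comp _) he (Category.id_comp _) he y) hS) =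
      mul (bact T.ext (𝟙 A) (𝟙 A) (Category.id_comp _) (Category.id_comp _) (Category.id_comp _)
        (Category.id_comp _) x)
        (bact a.ext (𝟙 A) n (Category.id_comp _) he (Category.id_comp _) he y) hS :=
  a.bact_mul_bact (𝟙 A) (𝟙 A) n _ _ _ _ he x y hS

/-- An algebra from an operation on the generic graded 2-cell which satisfies the laws. -/
noncomputable def ofBact {e : D ⟶ E} (φ : Gr T.carrier (.single (hom j e)) e)
    (h₁ : mul T.unit φ rfl = cart j e)
    (h₂ : mul (ofHom T.ext) φ rfl =
      paste (Cells.single (toHom (mul (cart j T.carrier) φ rfl))) φ (Category.id_comp _)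
        (Category.id_comp _)) : T.Alg D where
  carrier := e
  ext := toHom φ
  unit_mul_ext := by
    refine hom_ext (hf := Category.id_comp j) (hg := Category.id_comp e) ?_
    refine (ofHom_homMul _ _).trans ?_
    rw [ofHom_toHom, ofHom_toHom, h₁]
    exact (id_paste _).symm
  ext_mul_ext := by
    refine hom_ext (hf := Category.id_comp _) (hg := Category.id_comp e) ?_
    refine (ofHom_homMul _ _).trans (Eq.trans ?_ (ofHom_gcomp _ _).symm)
    have h₃ : ofHom (idCell (hom j T.carrier)) = cart j T.carrier := id_paste _
    rw [← toHom_ofHom (gcomp (Cells.pair _ _ _) _), ofHom_homMul, ofHom_toHom, h₂, h₃]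

end Alg

/-! ### Restriction of algebras and graded algebra morphisms -/

variable {M D D' : X}

theorem RestrictsTo.of_bact {m : T.Alg M} {c : D ⟶ M} {a : T.Alg D}
    (h : c ≫ m.carrier = a.carrier)
    (h' : bact m.ext (𝟙 A) c (Category.id_comp _) h (Category.id_comp _) h (cart j a.carrier) =
      ofHom a.ext) : RestrictsTo m c a :=
  ⟨h, (congrArg toHom h').trans (toHom_ofHom _)⟩

theorem RestrictsTo.bact_cart {m : T.Alg M} {c : D ⟶ M} {a : T.Alg D} (h : RestrictsTo m c a) :
    bact m.ext (𝟙 A) c (Category.id_comp _) h.carrier_eq (Category.id_comp _) h.carrier_eq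
      (cart j a.carrier) = ofHom a.ext :=
  (ofHom_toHom _).symm.trans (congrArg ofHom h.ext_eq)

theorem RestrictsTo.bact {m : T.Alg M} {c : D ⟶ M} {a : T.Alg D} (h : RestrictsTo m c a)
    {B : X} (l : B ⟶ A) (n : D' ⟶ D) {n' : D' ⟶ M} (hn : n ≫ c = n') {j₁ t₁ : B ⟶ E}
    {e₁ : D' ⟶ E} (hj : l ≫ j = j₁) (ht : l ≫ T.carrier = t₁) (he : n ≫ a.carrier = e₁)
    (he' : n' ≫ m.carrier = e₁) {P : Chain B D'} (x : Gr j₁ P e₁) :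
    bact m.ext l n' hj he' ht he' x = RelMonadicity.bact a.ext l n hj he ht he x := by
  rw [bact_eq_paste_bact_cart m.ext l n' (𝟙 A) c l n (Category.id_comp _) h.carrier_eq
    (Category.id_comp _) h.carrier_eq _ _ _ _ (Category.comp_id l) hn hj he ht he, h.bact_cart]
  rfl

theorem RestrictsTo.comp {m : T.Alg M} {c : D ⟶ M} {a : T.Alg D} (h : RestrictsTo m c a)
    {d : D' ⟶ D} {b : T.Alg D'} (h' : RestrictsTo a d b) : RestrictsTo m (d ≫ c) b := by
  refine .of_bact (by rw [Category.assoc, h.carrier_eq, h'.carrier_eq]) ?_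
  rw [h.bact (𝟙 A) d rfl _ _ h'.carrier_eq, h'.bact_cart]

theorem RestrictsTo.id (a : T.Alg D) : RestrictsTo a (𝟙 D) a :=
  .of_bact (Category.id_comp _) (RelMonadicity.bact_cart _)

/-- The restriction of an algebra along a tight-cell. -/
noncomputable def Alg.restrict (a : T.Alg D) (n : D' ⟶ D) : T.Alg D' :=
  .ofBact (e := n ≫ a.carrier)
    (RelMonadicity.bact a.ext (𝟙 A) n (Category.id_comp _) rfl (Category.id_comp _) rfl (cart j _))
    (by
      have h := a.unit_mul_bact (𝟙 A) n (Category.id_comp _) (Category.id_comp _) rfl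
        (cart j (n ≫ a.carrier))
      rwa [precomp_id] at h)
    (by
      have h := a.bact_cart_mul_bact n rfl (cart j T.carrier) (cart j (n ≫ a.carrier)) rfl
      rw [RelMonadicity.bact_cart] at h
      rw [← h]
      exact bact_eq_paste_bact_cart a.ext (𝟙 A) n (𝟙 A) n (𝟙 A) (𝟙 D') _ _ _ _ _ _ _ _
        (Category.comp_id _) (Category.id_comp _) _ _ _ _ _)

theorem Alg.restrict_restrictsTo (a : T.Alg D) (n : D' ⟶ D) : RestrictsTo a n (a.restrict n) :=
  .of_bact rfl (ofHom_toHom _).symm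

/-- The working form of the morphism condition: extension of the generic 2-cell commutes with
composition by ε on the right. -/
theorem isAlgHom_iff {a : T.Alg D} {a' : T.Alg D'} {P : Chain D D'}
    (ε : Gr a.carrier P a'.carrier) :
    IsAlgHom a a' (toHom ε) ↔
      RelMonadicity.bact a'.ext (𝟙 A) (𝟙 D') (Category.id_comp _) (Category.id_comp _)
        (Category.id_comp _) (Category.id_comp _) (mul (cart j a.carrier) ε rfl) =
      mul (ofHom a.ext) ε rfl := by
  have h₁ : ofHom (idCell (hom j a.carrier)) = cart j a.carrier := id_paste _
  have h₂ : gcomp (Cells.pair (idCell (hom j a.carrier)) (toHom ε) rfl)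
      (homMul j a.carrier a'.carrier) = toHom (mul (cart j a.carrier) ε rfl) := by
    rw [← toHom_ofHom (gcomp _ _), ofHom_homMul, h₁, ofHom_toHom]
  have h₃ : ofHom (gcomp (Cells.pair a.ext (toHom ε) rfl)
      (homMul T.carrier a.carrier a'.carrier)) = mul (ofHom a.ext) ε rfl := by
    rw [ofHom_homMul, ofHom_toHom]
  unfold IsAlgHom
  rw [h₂, ← h₃]
  constructor
  · intro h
    rw [← h, ofHom_gcomp]
    rfl
  · intro h
    refine hom_ext (hf := Category.id_comp _) (hg := Category.id_comp _) (Eq.trans ?_ h)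
    exact ofHom_gcomp _ _

/-! ### Lifting 2-cells through an algebra object -/

namespace AlgebraObject

variable (M : T.AlgebraObject)

theorem exists_lift {a : T.Alg D} {a' : T.Alg D'} {c : D ⟶ M.obj} {c' : D' ⟶ M.obj}
    (hc : RestrictsTo M.alg c a) (hc' : RestrictsTo M.alg c' a') {P : Chain D D'}
    (ε : Gr a.carrier P a'.carrier) (hε : IsAlgHom a a' (toHom ε)) :
    ∃ ε' : Gr c P c', whisker ε' M.forget hc.carrier_eq hc'.carrier_eq = ε := by
  obtain ⟨ε', h, -⟩ := M.existsUnique_cell a a' c c' hc hc' P (toHom ε) hε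
  refine ⟨ofHom ε', ?_⟩
  have := congrArg ofHom h
  rwa [ofHom_toHom, ofHom_toHom] at this

/-- Uniqueness of lifts is only available over a 2-cell known to be an algebra morphism, whence the
hypothesis on ε. -/
theorem whisker_injective {a : T.Alg D} {a' : T.Alg D'} {c : D ⟶ M.obj} {c' : D' ⟶ M.obj}
    (hc : RestrictsTo M.alg c a) (hc' : RestrictsTo M.alg c' a') {P : Chain D D'}
    {ε : Gr a.carrier P a'.carrier} (hε : IsAlgHom a a' (toHom ε)) {α β : Gr c P c'}
    (hα : whisker α M.forget hc.carrier_eq hc'.carrier_eq = ε)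
    (hβ : whisker β M.forget hc.carrier_eq hc'.carrier_eq = ε) : α = β := by
  have h := (M.existsUnique_cell a a' c c' hc hc' P (toHom ε) hε).unique (y₁ := toHom α)
    (y₂ := toHom β) (by rw [ofHom_toHom, hα]) (by rw [ofHom_toHom, hβ])
  have := congrArg ofHom h
  rwa [ofHom_toHom, ofHom_toHom] at this

end AlgebraObject

theorem isAlgHom_idGr (a : T.Alg D) : IsAlgHom a a (toHom (idGr a.carrier)) := by
  rw [isAlgHom_iff]
  have h := mul_id (cart j a.carrier)
  have h' := mul_id (ofHom a.ext)
  exact (congrArg _ h).trans ((RelMonadicity.bact_cart _).trans h'.symm)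

/-- Mutually inverse algebra morphisms lift to an isomorphism of tight-cells. -/
theorem AlgebraObject.tightIso (M : T.AlgebraObject) {a a' : T.Alg D} {c c' : D ⟶ M.obj}
    (hc : RestrictsTo M.alg c a) (hc' : RestrictsTo M.alg c' a')
    (θ : TightCell₂ a.carrier a'.carrier) (θ' : TightCell₂ a'.carrier a.carrier)
    (hθ : IsAlgHom a a' (toHom θ)) (hθ' : IsAlgHom a' a (toHom θ'))
    (h₁ : mul θ θ' rfl = idGr _) (h₂ : mul θ' θ rfl = idGr _) : TightIso c c' := by
  obtain ⟨α, hα⟩ := M.exists_lift hc hc' θ hθ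
  obtain ⟨β, hβ⟩ := M.exists_lift hc' hc θ' hθ'
  refine ⟨α, β, ?_, ?_⟩
  · refine M.whisker_injective hc hc (isAlgHom_idGr a) ?_ (whisker_idGr _ _ _)
    refine (whisker_mul α β rfl M.forget hc.carrier_eq hc'.carrier_eq
      hc.carrier_eq).trans ?_
    rw [hα, hβ, h₁]
  · refine M.whisker_injective hc' hc' (isAlgHom_idGr a') ?_ (whisker_idGr _ _ _)
    refine (whisker_mul β α rfl M.forget hc'.carrier_eq hc.carrier_eq
      hc'.carrier_eq).trans ?_
    rw [hα, hβ, h₂]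

end RelMonad

/-! ### Transposition -/

namespace LeftRelAdjoint

variable {A C E : X} {j : A ⟶ E} {r : C ⟶ E} (adj : LeftRelAdjoint j r)

/-- Treats two structures at once: taking y to be the left adjoint gives the extension operator of
the induced monad, and taking y to be the identity gives that of the canonical algebra on r. -/
theorem bact_ext {D : X} (y : D ⟶ C) {e : D ⟶ E} (he : y ≫ r = e) {B D' : X} (l : B ⟶ A)
    (n : D' ⟶ D) {n' : D' ⟶ C} (hn : n ≫ y = n') {j₁ t₁ : B ⟶ E} {l₁ : B ⟶ C} {e₁ : D' ⟶ E}
    (hj : l ≫ j = j₁) (hl : l ≫ adj.left = l₁) (ht : l ≫ adj.left ≫ r = t₁) (ht' : l₁ ≫ r = t₁)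
    (he₁ : n ≫ e = e₁) (he₂ : n' ≫ r = e₁) {P : Chain B D'} (x : Gr j₁ P e₁) :
    bact (adj.ext y he) l n hj he₁ ht he₁ x =
      whisker (bact adj.flat l n' hj he₂ hl (Category.comp_id n') x) r ht' he₂ := by
  unfold ext
  rw [bact.eq_1 (toHom _), ofHom_toHom, act_eq_bact,
    paste_whisker (hx₂ := hl) (hy₂ := hn) (hx₄ := ht') (hy₄ := he₂),
    paste_bact (hp := Category.comp_id l) (hq := hn) (hf₃ := hj) (hg₃ := he₁) (hf₅ := hj)
      (hg₅ := he₂), lift_cart]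

variable {B D : X} (l : B ⟶ A) (n : D ⟶ C) {j₁ t₁ : B ⟶ E} {l₁ : B ⟶ C} {e₁ : D ⟶ E}
    (hj : l ≫ j = j₁) (hl : l ≫ adj.left = l₁) (ht : l ≫ adj.left ≫ r = t₁) (ht' : l₁ ≫ r = t₁)
    (he : n ≫ r = e₁) {P : Chain B D}

/-- Writing x as an identity followed by x, naturality of transposition on the right leaves the
transpose of an identity, which is the unit. -/
theorem bact_sharp (x : Gr l₁ P n) :
    bact adj.sharp l n hl (Category.comp_id n) hj he x =
      mul (precomp l hj ht adj.unit) (whisker x r ht' he) rfl := by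
  have h := bact_mul_whisker adj.sharp l l₁ hl (Category.comp_id l₁) hj ht' (idGr l₁) x rfl
    (Category.comp_id n) he
  rw [whisker_id, id_mul] at h
  refine h.trans (congrArg (fun y => mul y (whisker x r ht' he) rfl) ?_)
  have h' := paste_bact adj.sharp (.nil l) (idGr adj.left) (Category.id_comp _)
    (Category.comp_id _) (Category.id_comp _) rfl (Category.comp_id l) hl hl hl hj ht
    hl (Category.comp_id l₁) hj ht'
  refine Eq.trans ?_ h'.symm
  exact congrArg _ (precomp_idGr l hl).symm

/-- Together with `flat_unit_mul_whisker`, this is the usual bijection of a relative adjunction: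
transposing is inverse to applying r and precomposing with the unit. -/
theorem unit_mul_whisker_flat (x : Gr j₁ P e₁) :
    mul (precomp l hj ht adj.unit)
      (whisker (bact adj.flat l n hj he hl (Category.comp_id n) x) r ht' he) rfl = x := by
  rw [← adj.bact_sharp l n hj hl ht ht' he, bact_bact, adj.flat_sharp, bact_id]

theorem flat_unit_mul_whisker (x : Gr l₁ P n) :
    bact adj.flat l n hj he hl (Category.comp_id n)
      (mul (precomp l hj ht adj.unit) (whisker x r ht' he) rfl) = x := by
  rw [← adj.bact_sharp l n hj hl ht ht' he]
  refine (bact_bact adj.sharp adj.flat l n _ _ _ _ _ _ x).trans ?_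
  rw [adj.sharp_flat, bact_id]

end LeftRelAdjoint

/-- A tight-cell is full when whiskering with it is surjective on graded 2-cells. -/
def IsFull {C C' : X} (c : C ⟶ C') : Prop :=
  ∀ {Y Y' : X} {x : Y ⟶ C} {y : Y' ⟶ C} {x' : Y ⟶ C'} {y' : Y' ⟶ C'} (hx : x ≫ c = x')
    (hy : y ≫ c = y') {P : Chain Y Y'} (f : Gr x' P y'), ∃ g : Gr x P y, whisker g c hx hy = f

/-! ### Comparing algebras for a `(j ; j')`-monad with algebras for a `j'`-monad -/

namespace LeftRelAdjoint

open RelMonad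

variable {A E E' D : X} {j : A ⟶ E} {j' : E ⟶ E'} {T : RelMonad (j ≫ j')} {τ : T.Alg D}
  (adj : LeftRelAdjoint j' τ.carrier)

/-- The 2-cell from the carrier of `T` to the carrier of the induced `j'`-monad restricted along
`j`, obtained by extending the unit of the latter. -/
noncomputable def monadMap : TightCell₂ T.carrier (j ≫ adj.monad.carrier) :=
  bact τ.ext (𝟙 A) (j ≫ adj.left) (Category.id_comp _) (Category.assoc _ _ _) (Category.id_comp _)
    (Category.assoc _ _ _) (precomp j rfl rfl adj.unit)

theorem unit_mul_monadMap : mul T.unit adj.monadMap rfl = precomp j rfl rfl adj.unit := by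
  have h := τ.unit_mul_bact (𝟙 A) (j ≫ adj.left) (Category.id_comp _) (Category.id_comp _)
    (Category.assoc _ _ _) (precomp j rfl rfl adj.unit)
  rwa [precomp_id] at h

variable {B : X}

theorem whisker_flat_eq_bact_alg (n : B ⟶ D) {e : B ⟶ E'} (he : n ≫ τ.carrier = e) {C : X}
    (l : C ⟶ E) {P : Chain C B} (x : Gr (l ≫ j') P e) :
    whisker (bact adj.flat l n rfl he rfl (Category.comp_id n) x) τ.carrier
      (Category.assoc _ _ _) he = bact adj.alg.ext l n rfl he rfl he x :=
  (adj.bact_ext (𝟙 D) (Category.id_comp _) l n (Category.comp_id n) rfl rfl rfl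
    (Category.assoc _ _ _) he he x).symm

/-- The extension operator of the induced monad is that of the algebra `r`, restricted along the
left adjoint. -/
theorem bact_monad_ext {C : X} (l : C ⟶ E) (n : B ⟶ E) {n' : B ⟶ D} (hn : n ≫ adj.left = n')
    {t : B ⟶ E'} (ht : n ≫ adj.left ≫ τ.carrier = t) (ht' : n' ≫ τ.carrier = t)
    {P : Chain C B} (x : Gr (l ≫ j') P t) :
    bact adj.monad.ext l n rfl ht rfl ht x = bact adj.alg.ext l n' rfl ht' rfl ht' x :=
  (adj.bact_ext adj.left rfl l n hn rfl rfl rfl (Category.assoc _ _ _) ht ht' x).trans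
    (adj.whisker_flat_eq_bact_alg _ ht' l x)

/-- The algebra structure on `r` is determined by the left adjoint of `r`. -/
theorem bact_eq_monadMap_mul_bact (n : B ⟶ D) {e : B ⟶ E'} (he : n ≫ τ.carrier = e)
    {P : Chain A B} (x : Gr (j ≫ j') P e) :
    bact τ.ext (𝟙 A) n (Category.id_comp _) he (Category.id_comp _) he x =
      mul adj.monadMap (bact adj.alg.ext j n rfl he rfl he x) rfl := by
  -- Once x is factored as the unit followed by r applied to its transpose, naturality of `τ.ext` on
  -- the right leaves the extension of the unit, which is `monadMap`.
  conv_lhs => rw [← adj.unit_mul_whisker_flat j n rfl rfl rfl (Category.assoc _ _ _) he x]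
  refine (bact_mul_whisker τ.ext (𝟙 A) (j ≫ adj.left) (Category.id_comp _) (Category.assoc _ _ _)
    (Category.id_comp _) (Category.assoc _ _ _) _ _ rfl he he).trans ?_
  exact congrArg (fun y => mul adj.monadMap y rfl) (adj.whisker_flat_eq_bact_alg n he j x)

/-- Compatibility of `monadMap` with the two extension operators. Associativity of τ applied to x
and the unit gives one side; rewriting the outer extension by `bact_eq_monadMap_mul_bact` gives the
other. -/
theorem ext_mul_monadMap {P : Chain A A} (x : Gr (j ≫ j') P T.carrier) :
    mul (bact T.ext (𝟙 A) (𝟙 A) (Category.id_comp _) (Category.id_comp _) (Category.id_comp _)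
      (Category.id_comp _) x) adj.monadMap P.append_nil =
    mul adj.monadMap (bact adj.monad.ext j j rfl rfl rfl rfl (mul x adj.monadMap P.append_nil))
      rfl := by
  refine (τ.bact_cart_mul_bact (j ≫ adj.left) (Category.assoc _ _ _) x _
    P.append_nil).symm.trans ?_
  refine (adj.bact_eq_monadMap_mul_bact _ (Category.assoc _ _ _) _).trans ?_
  exact congrArg (fun y => mul adj.monadMap y rfl)
    (adj.bact_monad_ext j j rfl rfl (Category.assoc _ _ _) _).symm

/-- Associativity of the transferred structure: `ext_mul_monadMap` moves the extension past
`monadMap`, and associativity of a, restricted along j, does the rest. -/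
theorem monadMap_mul_assoc (a : adj.monad.Alg B) {D' : X} (n : D' ⟶ B) {e : D' ⟶ E'}
    (he : n ≫ a.carrier = e) {P : Chain A A} {Q S : Chain A D'} (x : Gr (j ≫ j') P T.carrier)
    (y : Gr (j ≫ j') Q e) (hS : P.append Q = S) :
    mul (bact T.ext (𝟙 A) (𝟙 A) (Category.id_comp _) (Category.id_comp _) (Category.id_comp _)
      (Category.id_comp _) x) (mul adj.monadMap (bact a.ext j n rfl he rfl he y) rfl) hS =
    mul adj.monadMap (bact a.ext j n rfl he rfl he
      (mul x (mul adj.monadMap (bact a.ext j n rfl he rfl he y) rfl) hS)) rfl := by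
  refine (mul_assoc _ adj.monadMap _ P.append_nil hS rfl hS).symm.trans ?_
  refine (congrArg (fun z => mul z _ hS) (adj.ext_mul_monadMap x)).trans ?_
  refine (mul_assoc (P := .nil A) (Q := P) adj.monadMap _ _ rfl hS hS rfl).trans ?_
  refine congrArg (fun z => mul adj.monadMap z rfl) ?_
  refine (a.bact_mul_bact j j n rfl rfl rfl rfl he _ y hS).symm.trans ?_
  exact congrArg (bact a.ext j n rfl he rfl he)
    (mul_assoc x adj.monadMap _ P.append_nil hS rfl hS)

/-- The `T`-algebra underlying an algebra for the induced `j'`-monad. -/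
noncomputable def transfer (a : adj.monad.Alg B) : T.Alg B :=
  .ofBact (mul adj.monadMap (bact a.ext j (𝟙 B) rfl (Category.id_comp _) rfl (Category.id_comp _)
      (cart (j ≫ j') a.carrier)) rfl)
    (by
      refine (mul_assoc T.unit adj.monadMap _ rfl rfl rfl rfl).symm.trans ?_
      rw [unit_mul_monadMap]
      exact a.unit_mul_bact j (𝟙 B) rfl rfl (Category.id_comp _) _)
    (by
      -- The law is the previous lemma at cartesian 2-cells; what follows only rewrites its right
      -- side as a pasting onto the generic structure 2-cell.
      have h := adj.monadMap_mul_assoc a (𝟙 B) (Category.id_comp _) (cart (j ≫ j') T.carrier)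
        (cart (j ≫ j') a.carrier) rfl
      rw [bact_cart] at h
      refine h.trans ?_
      have h₂ := paste_mul (.nil (𝟙 A)) (Cells.single (toHom (mul (cart (j ≫ j') T.carrier)
        (mul adj.monadMap (bact a.ext j (𝟙 B) rfl (Category.id_comp _) rfl (Category.id_comp _)
          (cart (j ≫ j') a.carrier)) rfl) rfl))) adj.monadMap (bact a.ext j (𝟙 B) rfl
          (Category.id_comp _) rfl (Category.id_comp _) (cart (j ≫ j') a.carrier))
        (Category.id_comp _) (Category.id_comp _) (Category.id_comp _)
      refine Eq.trans ?_ h₂.symm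
      have h₃ := precomp_id adj.monadMap
      refine congrArg₂ (fun α β => mul α β rfl) h₃.symm ?_
      exact bact_eq_paste_bact_cart a.ext j (𝟙 B) j (𝟙 B) (𝟙 A) (𝟙 B) _ _ _ _ _ _ _ _
        (Category.id_comp _) (Category.id_comp _) _ _ _ _ _)

theorem bact_transfer (a : adj.monad.Alg B) {D' : X} (n : D' ⟶ B) {e : D' ⟶ E'}
    (he : n ≫ a.carrier = e) {P : Chain A D'} (x : Gr (j ≫ j') P e) :
    bact (adj.transfer a).ext (𝟙 A) n (Category.id_comp _) he (Category.id_comp _) he x =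
      mul adj.monadMap (bact a.ext j n rfl he rfl he x) rfl := by
  have h := paste_mul (.nil (𝟙 A)) (Cells.single (lift x (Category.id_comp _) he)) adj.monadMap
    (bact a.ext j (𝟙 B) rfl (Category.id_comp _) rfl (Category.id_comp _)
      (cart (j ≫ j') a.carrier)) (Category.id_comp _) (Category.id_comp _) he
  refine Eq.trans ?_ (h.trans ?_)
  · unfold bact transfer Alg.ofBact
    exact congrArg (fun y => paste (Cells.single (lift x (Category.id_comp _) he)) y
      (Category.id_comp _) he) (ofHom_toHom _)
  · have h₃ := precomp_id adj.monadMap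
    refine congrArg₂ (fun α β => mul α β rfl) h₃ ?_
    exact (bact_eq_paste_bact_cart a.ext j n j (𝟙 B) (𝟙 A) n _ _ _ _ _ _ _ _
      (Category.id_comp _) (Category.comp_id _) _ _ _ _ _).symm

/-- Transfer adds a left factor `monadMap` that does not involve the algebra, so restriction on the
right passes through it. -/
theorem transfer_restrictsTo {C : X} {a : adj.monad.Alg B} {b : adj.monad.Alg C} {c : C ⟶ B}
    (h : RestrictsTo a c b) : RestrictsTo (adj.transfer a) c (adj.transfer b) := by
  refine .of_bact h.carrier_eq ?_
  refine (adj.bact_transfer a c h.carrier_eq _).trans (Eq.trans ?_ (bact_cart _))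
  refine Eq.trans ?_ (adj.bact_transfer b (𝟙 C) (Category.id_comp _) _).symm
  congr 1
  exact h.bact j (𝟙 C) (Category.id_comp c) _ _ _ _ _

/-- By `bact_eq_monadMap_mul_bact`, transferring the canonical algebra on r returns the structure of
τ, so both are classified by the same tight-cell. -/
theorem restrictsTo_transfer_alg {M : X} {m : T.Alg M} {c : D ⟶ M} (h : RestrictsTo m c τ) :
    RestrictsTo m c (adj.transfer adj.alg) := by
  refine .of_bact h.carrier_eq (h.bact_cart.trans ?_)
  rw [← bact_cart, ← bact_cart]
  refine (adj.bact_eq_monadMap_mul_bact (𝟙 D) (Category.id_comp _) _).trans ?_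
  exact (adj.bact_transfer adj.alg (𝟙 D) (Category.id_comp _) _).symm

/-- Extension along an algebra for the induced `j'`-monad gives a graded morphism of
`T`-algebras. -/
theorem isAlgHom_transfer (a : adj.monad.Alg B) {P : Chain E B} (x : Gr j' P a.carrier) :
    IsAlgHom (τ.restrict adj.left) (adj.transfer a)
      (toHom (bact a.ext (𝟙 E) (𝟙 B) (Category.id_comp _) (Category.id_comp _)
        (Category.id_comp _) (Category.id_comp _) x :
          Gr (adj.left ≫ τ.carrier) P a.carrier)) := by
  have hτ := τ.restrict_restrictsTo adj.left
  refine (isAlgHom_iff (a := τ.restrict adj.left) (a' := adj.transfer a) _).2 ?_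
  refine (adj.bact_transfer a (𝟙 B) (Category.id_comp _) _).trans ?_
  refine Eq.trans ?_ (congrArg (fun y => mul y _ rfl)
    ((adj.bact_eq_monadMap_mul_bact adj.left rfl _).symm.trans hτ.bact_cart))
  refine Eq.trans ?_ (mul_assoc (P := .nil A)
    (Q := .single (hom (j ≫ j') (adj.left ≫ τ.carrier))) (R := P) (f := T.carrier)
    (g := j ≫ adj.monad.carrier) (h := adj.monad.carrier) (k := a.carrier)
    adj.monadMap _ _ rfl rfl rfl rfl).symm
  refine congrArg (fun z => mul adj.monadMap z rfl) ?_
  -- With the common left factor `monadMap` removed, the morphism condition is the associativity law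
  -- of a.
  refine (a.bact_mul_bact j (𝟙 E) (𝟙 B) rfl rfl (Category.id_comp _) (Category.id_comp _)
    (Category.id_comp _) (cart (j ≫ j') (adj.left ≫ τ.carrier)) x rfl).trans ?_
  congr 1
  exact adj.bact_monad_ext j (𝟙 E) (Category.id_comp _) (Category.id_comp _) rfl _

/-- An algebra for the induced `j'`-monad whose underlying `T`-algebra is isomorphic to a
restriction of `r` is itself isomorphic to a restriction of `r`. -/
theorem bact_mul_whisker_iso (M : T.AlgebraObject) {c : D ⟶ M.obj}
    (hc : RestrictsTo M.alg c τ) (hfull : IsFull c) (a : adj.monad.Alg B) {d : B ⟶ M.obj}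
    (hd : RestrictsTo M.alg d (adj.transfer a)) {y : B ⟶ D} {y' : B ⟶ M.obj} (hy : y ≫ c = y')
    {e : B ⟶ E'} (he : y ≫ τ.carrier = e)
    {κ : TightCell₂ y' d} {κ' : TightCell₂ d y'} (h₁ : mul κ κ' rfl = idGr y')
    (h₂ : mul κ' κ rfl = idGr d) (hy' : y' ≫ M.forget = e) {P : Chain E B}
    (x : Gr j' P e) :
    bact a.ext (𝟙 E) (𝟙 B) (Category.id_comp _) (Category.id_comp _) (Category.id_comp _)
        (Category.id_comp _) (mul x (whisker κ M.forget hy' hd.carrier_eq) P.append_nil) =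
      mul (bact adj.alg.ext (𝟙 E) y (Category.id_comp _) he (Category.id_comp _) he x)
        (whisker κ M.forget hy' hd.carrier_eq) P.append_nil := by
  have e₁ : mul (whisker κ M.forget hy' hd.carrier_eq) (whisker κ' M.forget hd.carrier_eq hy')
      rfl = idGr e :=
    (whisker_mul κ κ' rfl M.forget hy' hd.carrier_eq hy').symm.trans
      ((congrArg (fun α => whisker α M.forget hy' hy') h₁).trans (whisker_idGr _ _ _))
  have e₂ : mul (whisker κ' M.forget hd.carrier_eq hy') (whisker κ M.forget hy' hd.carrier_eq)
      rfl = idGr (adj.transfer a).carrier :=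
    (whisker_mul κ' κ rfl M.forget hd.carrier_eq hy' hd.carrier_eq).symm.trans
      ((congrArg (fun α => whisker α M.forget hd.carrier_eq hd.carrier_eq) h₂).trans
        (whisker_idGr _ _ _))
  set θ : TightCell₂ e a.carrier := whisker κ M.forget hy' hd.carrier_eq with hθ
  set θ' : TightCell₂ a.carrier e := whisker κ' M.forget hd.carrier_eq hy' with hθ'
  -- The extension in a of x transported along θ. It is an algebra morphism out of τ restricted
  -- along the left adjoint, so it lifts through the forgetful tight-cell of T.
  set w : Gr (adj.left ≫ τ.carrier) P a.carrier :=
    bact a.ext (𝟙 E) (𝟙 B) (Category.id_comp _) (Category.id_comp _) (Category.id_comp _)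
        (Category.id_comp _) (mul x θ P.append_nil) with hw
  have hl : RestrictsTo M.alg (adj.left ≫ c) (τ.restrict adj.left) :=
    hc.comp (τ.restrict_restrictsTo adj.left)
  obtain ⟨ε, hε⟩ := M.exists_lift hl hd w (adj.isAlgHom_transfer a _)
  -- After κ' the lift ends at y followed by c, so fullness of c brings it back to a 2-cell from the
  -- left adjoint to y.
  obtain ⟨g, hg⟩ := hfull rfl hy (mul ε κ' P.append_nil)
  have hgr : whisker g τ.carrier rfl he = mul w θ' P.append_nil := by
    refine (whisker_whisker g c M.forget hc.carrier_eq rfl hy hl.carrier_eq hy' _ _).symm.trans ?_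
    rw [hg]
    refine (whisker_mul ε κ' P.append_nil M.forget hl.carrier_eq hd.carrier_eq hy').trans ?_
    exact congrArg (fun α => mul α θ' P.append_nil) hε
  have hu : mul adj.unit w rfl = mul x θ P.append_nil := by
    have h := a.unit_mul_bact (𝟙 E) (𝟙 B) (Category.id_comp _) (Category.id_comp _)
      (Category.id_comp _) (mul x θ P.append_nil)
    rwa [precomp_id] at h
  have hx : mul adj.unit (mul w θ' P.append_nil) rfl = x := by
    refine (mul_assoc adj.unit w θ' rfl P.append_nil P.append_nil rfl).symm.trans ?_
    refine (congrArg (fun α => mul α θ' P.append_nil) hu).trans ?_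
    refine (mul_assoc x θ θ' P.append_nil P.append_nil rfl P.append_nil).trans ?_
    exact (congrArg (fun α => mul x α P.append_nil) e₁).trans (mul_id x)
  -- By `hgr` and `hx`, applying r to g and precomposing with the unit yields x; hence g is the
  -- transpose of x.
  have hflat : bact adj.flat (𝟙 E) y (Category.id_comp _) he (Category.id_comp _)
      (Category.comp_id y) x = g := by
    have h := adj.flat_unit_mul_whisker (𝟙 E) y (Category.id_comp _) (Category.id_comp _)
      (Category.id_comp _) rfl he g
    rw [precomp_id, hgr] at h
    refine Eq.trans ?_ h
    exact congrArg _ hx.symm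
  have hσ : bact adj.alg.ext (𝟙 E) y (Category.id_comp _) he (Category.id_comp _) he x =
      mul w θ' P.append_nil := by
    refine (adj.bact_ext (𝟙 D) (Category.id_comp _) (𝟙 E) y (Category.comp_id y)
      (Category.id_comp _) (Category.id_comp _) (Category.id_comp _) rfl he he x).trans ?_
    rw [← hgr, ← hflat]
  refine Eq.trans ?_ (congrArg (fun α => mul α θ P.append_nil) hσ.symm)
  refine Eq.trans ?_ (mul_assoc w θ' θ P.append_nil P.append_nil rfl P.append_nil).symm
  exact ((congrArg (fun α => mul w α P.append_nil) e₂).trans (mul_id w)).symm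

end LeftRelAdjoint

/-! ### Equivalences are full -/

theorem mul_left_injective_of_mul_eq_idGr {A B E : X} {f g : A ⟶ E} {h : B ⟶ E} {P : Chain A B}
    {α : TightCell₂ f g} {α' : TightCell₂ g f} (hα : mul α' α rfl = idGr g) {x y : Gr g P h}
    (e : mul α x rfl = mul α y rfl) : x = y := by
  have key (x : Gr g P h) : mul α' (mul α x rfl) rfl = x :=
    (mul_assoc (P := .nil A) (Q := .nil A) α' α x rfl rfl rfl rfl).symm.trans
      ((congrArg (fun β => mul β x rfl) hα).trans (id_mul x))
  exact (key x).symm.trans ((congrArg (fun β => mul α' β rfl) e).trans (key y))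

theorem mul_right_injective_of_mul_eq_idGr {A B E : X} {f : A ⟶ E} {g h : B ⟶ E} {P : Chain A B}
    {α : TightCell₂ g h} {α' : TightCell₂ h g} (hα : mul α α' rfl = idGr g) {x y : Gr f P g}
    (e : mul x α P.append_nil = mul y α P.append_nil) : x = y := by
  have key (x : Gr f P g) : mul (mul x α P.append_nil) α' P.append_nil = x :=
    (mul_assoc (Q := .nil B) (R := .nil B) x α α' P.append_nil P.append_nil rfl
      P.append_nil).trans ((congrArg (fun β => mul x β P.append_nil) hα).trans (mul_id x))
  exact (key x).symm.trans ((congrArg (fun β => mul β α' P.append_nil) e).trans (key y))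

theorem precomp_mul_eq_idGr {A B E : X} (l : A ⟶ B) {f g : B ⟶ E} {f' g' : A ⟶ E}
    (hf : l ≫ f = f') (hg : l ≫ g = g') {α : TightCell₂ f g} {β : TightCell₂ g f}
    (h : mul α β rfl = idGr f) :
    mul (precomp l hf hg α) (precomp l hg hf β) rfl = idGr f' :=
  (precomp_mul l hf hg hf α β).symm.trans
    ((congrArg (precomp l hf hf) h).trans (precomp_idGr l hf))

theorem whisker_id' {A B C : X} {x : A ⟶ C} {y : B ⟶ C} {P : Chain A B} (a : Gr x P y)
    (hx : x ≫ 𝟙 C = x) (hy : y ≫ 𝟙 C = y) : whisker a (𝟙 C) hx hy = a :=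
  LeftRelAdjoint.whisker_id a

theorem isFull_id (C : X) : IsFull (𝟙 C) := by
  intro Y Y' x y x' y' hx hy P f
  obtain rfl : x = x' := by rw [← hx, Category.comp_id]
  obtain rfl : y = y' := by rw [← hy, Category.comp_id]
  exact ⟨f, whisker_id' f hx hy⟩

/-- Whiskering with a tight-cell which has a retraction up to isomorphism is injective. -/
theorem whisker_injective_of_tightIso {C C' : X} {c : C ⟶ C'} {d : C' ⟶ C}
    (h : TightIso (c ≫ d) (𝟙 C)) {A B : X} {x : A ⟶ C} {y : B ⟶ C} {P : Chain A B}
    {α β : Gr x P y} {x' : A ⟶ C'} {y' : B ⟶ C'} (hx : x ≫ c = x') (hy : y ≫ c = y')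
    (e : whisker α c hx hy = whisker β c hx hy) : α = β := by
  obtain ⟨κ, κ', -, h₂⟩ := h
  have hx₁ : x ≫ c ≫ d = x' ≫ d := by rw [← hx, Category.assoc]
  have hy₁ : y ≫ c ≫ d = y' ≫ d := by rw [← hy, Category.assoc]
  refine mul_left_injective_of_mul_eq_idGr
    (precomp_mul_eq_idGr x (Category.comp_id x) hx₁ h₂) ?_
  -- Naturality of κ expresses α, up to an invertible left factor, through its image under c.
  have key (α : Gr x P y) : mul (precomp x hx₁ (Category.comp_id x) κ) α rfl =
      mul (whisker (whisker α c hx hy) d rfl rfl) (precomp y hy₁ (Category.comp_id y) κ)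
        P.append_nil := by
    have h := whisker_naturality α κ hx₁ hy₁ (Category.comp_id x) (Category.comp_id y)
    rw [whisker_id', ← whisker_whisker α c d rfl hx hy rfl rfl hx₁ hy₁] at h
    exact h.symm
  rw [key, key, e]

/-- The preimage of f is f whiskered by d and conjugated by the isomorphism between c ; d and the
identity. That it maps to f may be tested after whiskering with d, which is injective because d ; c
is isomorphic to the identity; no triangle identity is needed. -/
theorem IsTightEquivalence.isFull {C C' : X} {c : C ⟶ C'} (h : IsTightEquivalence c) :
    IsFull c := by
  obtain ⟨d, ⟨ε, ε', h₁, h₂⟩, hdc⟩ := h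
  intro Y Y' x y x' y' hx hy P f
  have hx₁ : x ≫ c ≫ d = x' ≫ d := by rw [← hx, Category.assoc]
  have hy₁ : y ≫ c ≫ d = y' ≫ d := by rw [← hy, Category.assoc]
  let fd : Gr (x' ≫ d) P (y' ≫ d) := whisker f d rfl rfl
  let g : Gr x P y := mul (precomp x (Category.comp_id x) hx₁ ε')
    (mul fd (precomp y hy₁ (Category.comp_id y) ε) P.append_nil) rfl
  refine ⟨g, whisker_injective_of_tightIso hdc rfl rfl ?_⟩
  refine (whisker_whisker g c d rfl hx hy rfl rfl hx₁ hy₁).trans ?_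
  refine mul_right_injective_of_mul_eq_idGr
    (precomp_mul_eq_idGr y hy₁ (Category.comp_id y) h₁) ?_
  refine (whisker_naturality g ε hx₁ hy₁ (Category.comp_id x) (Category.comp_id y)).trans ?_
  rw [whisker_id']
  refine (mul_assoc (P := .nil Y) (Q := .nil Y) _ _ _ rfl rfl rfl rfl).symm.trans ?_
  refine (congrArg (fun β => mul β _ rfl)
    (precomp_mul_eq_idGr x hx₁ (Category.comp_id x) h₁)).trans ?_
  exact id_mul _

/-! ### The comparison tight-cell -/

namespace LeftRelAdjoint

open RelMonad

variable {A E E' D : X} {j : A ⟶ E} {j' : E ⟶ E'} {T : RelMonad (j ≫ j')} {τ : T.Alg D}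
  (adj : LeftRelAdjoint j' τ.carrier)

/-- Both tight-cells classify the T-algebra transferred from the canonical algebra on r. -/
theorem comparison_comp_eq (M : T.AlgebraObject) {c : D ⟶ M.obj} (hc : RestrictsTo M.alg c τ)
    (M' : adj.monad.AlgebraObject) {d : M'.obj ⟶ M.obj}
    (hd : RestrictsTo M.alg d (adj.transfer M'.alg)) : adj.comparison M' ≫ d = c :=
  (M.existsUnique_tight (adj.transfer adj.alg)).unique
    (hd.comp (adj.transfer_restrictsTo (adj.comparison_restrictsTo M')))
    (adj.restrictsTo_transfer_alg hc)

theorem isIso_comparison (M : T.AlgebraObject) (adj : LeftRelAdjoint j' M.forget)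
    (M' : adj.monad.AlgebraObject) : IsIso (adj.comparison M') := by
  obtain ⟨d, hd, -⟩ := M.existsUnique_tight (adj.transfer M'.alg)
  have hc : RestrictsTo M.alg (𝟙 _) M.alg := .id M.alg
  refine ⟨d, adj.comparison_comp_eq M hc M' hd, ?_⟩
  have hd' : d ≫ M.forget = M'.forget := hd.carrier_eq
  -- The canonical algebra restricts along d to the universal one, by the key lemma with c and the
  -- isomorphism both identities. Hence d followed by the comparison classifies the universal
  -- algebra, as the identity does.
  have hr : RestrictsTo adj.alg d M'.alg := by
    refine .of_bact hd' ?_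
    have hid : mul (idGr d) (idGr d) rfl = idGr d := id_mul _
    have h := adj.bact_mul_whisker_iso M hc (isFull_id _) M'.alg hd (Category.comp_id d) hd'
      hid hid hd' (cart j' M'.forget)
    have hw : whisker (idGr d) M.forget hd' hd' = idGr M'.forget := whisker_idGr d M.forget hd'
    have hm {B : X} {f : B ⟶ E'} {P : Chain B M'.obj} (x : Gr f P M'.forget) :
        mul x (whisker (idGr d) M.forget hd' hd') P.append_nil = x :=
      (congrArg (fun z => mul x z P.append_nil) hw).trans (mul_id x)
    refine (hm _).symm.trans (h.symm.trans (Eq.trans ?_ (bact_cart M'.alg.ext)))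
    exact congrArg _ (hm (cart j' M'.forget))
  exact (M'.existsUnique_tight M'.alg).unique ((adj.comparison_restrictsTo M').comp hr)
    (.id M'.alg)

/-- The pseudo-inverse is d ; c'. One composite is c ; c'. The other classifies the canonical
algebra restricted along d ; c', and the isomorphism between d ; c' ; c and d induces an isomorphism
of that algebra with the universal one. -/
theorem isTightEquivalence_comparison (M : T.AlgebraObject) {c : D ⟶ M.obj}
    (hc : RestrictsTo M.alg c τ) (he : IsTightEquivalence c) (M' : adj.monad.AlgebraObject) :
    IsTightEquivalence (adj.comparison M') := by
  have hfull : IsFull c := he.isFull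
  obtain ⟨c', hcc', κ, κ', hκ, hκ'⟩ := he
  obtain ⟨d, hd, -⟩ := M.existsUnique_tight (adj.transfer M'.alg)
  refine ⟨d ≫ c', ?_, ?_⟩
  · rwa [← Category.assoc, adj.comparison_comp_eq M hc M' hd]
  have hy₁ : d ≫ c' ≫ c = (d ≫ c') ≫ c := (Category.assoc _ _ _).symm
  have hy' : ((d ≫ c') ≫ c) ≫ M.forget = (d ≫ c') ≫ τ.carrier := by
    rw [Category.assoc, hc.carrier_eq]
  have h₁ := precomp_mul_eq_idGr d hy₁ (Category.comp_id d) hκ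
  have h₂ := precomp_mul_eq_idGr d (Category.comp_id d) hy₁ hκ'
  set K := precomp d hy₁ (Category.comp_id d) κ
  set K' := precomp d (Category.comp_id d) hy₁ κ'
  let θ : TightCell₂ ((d ≫ c') ≫ τ.carrier) M'.forget := whisker K M.forget hy' hd.carrier_eq
  let θ' : TightCell₂ M'.forget ((d ≫ c') ≫ τ.carrier) := whisker K' M.forget hd.carrier_eq hy'
  have e₁ : mul θ θ' rfl = idGr ((d ≫ c') ≫ τ.carrier) :=
    (whisker_mul K K' rfl M.forget hy' hd.carrier_eq hy').symm.trans
      ((congrArg (fun α => whisker α M.forget hy' hy') h₁).trans (whisker_idGr _ _ _))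
  have e₂ : mul θ' θ rfl = idGr M'.forget :=
    (whisker_mul K' K rfl M.forget hd.carrier_eq hy' hd.carrier_eq).symm.trans
      ((congrArg (fun α => whisker α M.forget hd.carrier_eq hd.carrier_eq) h₂).trans
        (whisker_idGr _ _ _))
  have hr := adj.alg.restrict_restrictsTo (d ≫ c')
  have key {P : Chain E M'.obj} (x : Gr j' P ((d ≫ c') ≫ τ.carrier)) :
      bact M'.alg.ext (𝟙 E) (𝟙 _) (Category.id_comp _) (Category.id_comp _) (Category.id_comp _)
        (Category.id_comp _) (mul x θ P.append_nil) =
      mul (bact adj.alg.ext (𝟙 E) (d ≫ c') (Category.id_comp _) rfl (Category.id_comp _) rfl x)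
        θ P.append_nil :=
    adj.bact_mul_whisker_iso M hc hfull M'.alg hd rfl rfl h₁ h₂ hy' x
  have cancel {B : X} {f : B ⟶ E'} {P : Chain B M'.obj} (x : Gr f P M'.forget) :
      mul (mul x θ' P.append_nil) θ P.append_nil = x :=
    (mul_assoc x θ' θ P.append_nil P.append_nil rfl P.append_nil).trans
      ((congrArg (fun z => mul x z P.append_nil) e₂).trans (mul_id x))
  refine M'.tightIso ((adj.comparison_restrictsTo M').comp hr) (.id M'.alg) θ θ' ?_ ?_ e₁ e₂
  · refine (isAlgHom_iff (a := adj.alg.restrict (d ≫ c')) (a' := M'.alg) θ).2 ?_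
    refine (key (cart j' _)).trans ?_
    exact congrArg (fun z => mul z θ rfl) hr.bact_cart
  -- The condition for θ' may be tested after composing with the invertible θ, where it follows from
  -- `key` at the cartesian 2-cell followed by θ'.
  · refine (isAlgHom_iff (a := M'.alg) (a' := adj.alg.restrict (d ≫ c')) θ').2 ?_
    refine mul_right_injective_of_mul_eq_idGr (P := .single (hom j' M'.forget)) (α := θ) e₁ ?_
    refine Eq.trans ?_ (Eq.trans (bact_cart M'.alg.ext)
      (cancel (ofHom M'.alg.ext)).symm)
    refine (congrArg (fun z => mul z θ rfl)
      (hr.bact (𝟙 E) (𝟙 _) (Category.id_comp _) _ _ _ rfl _).symm).trans ?_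
    refine (key (mul (cart j' M'.forget) θ' rfl)).symm.trans ?_
    exact congrArg _ (cancel (cart j' M'.forget))

end LeftRelAdjoint

end

end RelMonadicity

/-! ### The strict and non-strict monadicity criteria -/

theorem mainTheorem8 {X : Type u} [RelMonadicity.VirtualEquipment.{u, v, w, z} X]
    {A E E' : X} (j : A ⟶ E) (j' : E ⟶ E') (hj' : RelMonadicity.IsDense j') :
    (∀ (T : RelMonadicity.RelMonad (j ≫ j')) (M : T.AlgebraObject),
      RelMonadicity.IsStrictlyMonadic j' M.forget ↔
        ∃ adj : RelMonadicity.LeftRelAdjoint j' M.forget, Nonempty adj.monad.AlgebraObject) ∧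
    (∀ (D : X) (r : D ⟶ E'), RelMonadicity.IsNonstrictlyMonadic (j ≫ j') r →
      (RelMonadicity.IsNonstrictlyMonadic j' r ↔
        ∃ adj : RelMonadicity.LeftRelAdjoint j' r, Nonempty adj.monad.AlgebraObject)) := by
  refine ⟨fun T M => ⟨?_, ?_⟩, fun D r hr => ⟨?_, ?_⟩⟩
  · rintro ⟨adj, M', -⟩
    exact ⟨adj, ⟨M'⟩⟩
  · rintro ⟨adj, ⟨M'⟩⟩
    exact ⟨adj, M', RelMonadicity.LeftRelAdjoint.isIso_comparison M adj M'⟩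
  · rintro ⟨adj, M', -⟩
    exact ⟨adj, ⟨M'⟩⟩
  · rintro ⟨adj, ⟨M'⟩⟩
    obtain ⟨adj₀, M, he⟩ := hr
    -- Here T is the monad of the given (j ; j')-adjunction, τ its canonical algebra on r, and c its
    -- comparison tight-cell.
    exact ⟨adj, M', RelMonadicity.LeftRelAdjoint.isTightEquivalence_comparison
      (τ := adj₀.alg) adj M (adj₀.comparison_restrictsTo M) he M'⟩
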